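/- Conventions. Let $\hat f(\xi)=\int e^{-2\pi i x\cdot\xi}f(x)\,dx$, extended to (complex-valued) tempered distributions on $\mathbb{R}^d$. For a weight $w:[0,\infty)\to(0,\infty)$ and $\sigma\in\mathbb{R}$, let $\dot H^\sigma_w$ (resp. $H^\sigma_w$) be the set of $f\in\mathscr{S}'(\mathbb{R}^d)$ with $\hat f\in L^1_{loc}$ and finite norm $$\|f\|_{\dot H^\sigma_w}=\big\||\xi|^\sigma w(|\xi|)\hat f\big\|_{L^2},\qquad \|f\|_{H^\sigma_w}=\big\|(1+|\xi|^2)^{\sigma/2}w(|\xi|)\hat f\big\|_{L^2}.$$ Let $\mathscr{M}_W$ be the class of quotients $w=w_a/w_b$ where $w_a,w_b\in C^1([0,\infty))$ are positive and nondecreasing and each satisfies, for some constant $C>0$, $rw'(r)\le Cw(r)$ for all $r\ge0$ and $w(r_1r_2)\le C(w(r_1)+w(r_2))$ for all $r_1,r_2\ge0$. Fix a nonnegative radial $\phi\in\mathscr{S}(\mathbb{R}^d)$ with $\operatorname{supp}\phi\subset\{1/2<|\xi|<2\}$ and $\sum_{j\in\mathbb{Z}}\phi(2^{-j}\xi)=1$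 for $\xi\ne0$, and let $\mathcal{F}(\triangle_jf)=\phi(2^{-j}\cdot)\hat f$. The product $fg$ of two tempered distributions with $\hat f,\hat g\in L^1_{loc}$ is the limit in $\mathscr{S}'$, as $n\to\infty$, of the pointwise products $\mathcal{F}^{-1}(\chi(2^{-n}\cdot)\hat f)\cdot\mathcal{F}^{-1}(\chi(2^{-n}\cdot)\hat g)$, required to exist and be the same for all $\chi\in C_c^\infty(\mathbb{R}^d)$ equal to $1$ near $0$. Theorem. Let $d\ge2$ and let $s,\bar s\in\mathbb{R}$ satisfy $s,\bar s\le d/2$ and $s+\bar s>0$. Let $\omega,\omega_\ell,\tilde\omega_\ell\in\mathscr{M}_W$ for $\ell=1,2,3$, and let $\Gamma_1,\Gamma_2,\Gamma_3:[0,\infty)\to[0,\infty)$ be functions such that, for some $C_1,C_2,C_3>0$ and all $y\ge0$, $$\frac{\omega(y)}{\tilde\omega_1(y)}I_s(\omega_1;y)^{1/2}\le C_1\Gamma_1(y),\qquad \frac{\omega(y)}{\tilde\omega_2(y)}I_{\bar s}(\omega_2;y)^{1/2}\le C_2\Gamma_2(y),\qquad \frac{\omega(y)}{\omega_3(y)\tilde\omega_3(y)}\le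 C_3\Gamma_3(y),$$ where $$I_r(w;y)=\int_0^1\frac{\tau^{d-2r-1}}{w(y\tau)^2}\,d\tau\ \text{ if } r<d/2,\qquad I_{d/2}(w;y)=\int_0^y\frac{\tau^{d-1}}{(1+\tau^2)^{d/2}w(\tau)^2}\,d\tau .$$ Put $$\pi^{r,t}_{\varrho,\tilde\varrho}(f,g)=\begin{cases}\|f\|_{\dot H^r_\varrho}\|g\|_{\dot H^t_{\tilde\varrho}},&r<d/2,\\ \|f\|_{H^r_\varrho}\|g\|_{\dot H^t_{\tilde\varrho}},&r=d/2,\end{cases}\qquad \rho^{r,t}_{\varrho,\tilde\varrho}(f,g)=\|f\|_{\dot H^r_\varrho}\|g\|_{\dot H^t_{\tilde\varrho}}.$$ Then there is a constant $C>0$ such that, for all $f,g$ for which all the norms of $f$ and of $g$ occurring in $\pi^{s,\bar s}_{\omega_1,\tilde\omega_1}(f,g)$, $\pi^{\bar s,s}_{\omega_2,\tilde\omega_2}(g,f)$ and $\rho^{s,\bar s}_{\omega_3,\tilde\omega_3}(f,g)$ are finite, the product $fg\in\mathscr{S}'(\mathbb{R}^d)$ exists and the following two assertions hold. (i) There is a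 nonnegative sequence $(c_j)_{j\in\mathbb{Z}}$ (depending on $f,g$) with $\sum_jc_j^2\le1$ such that for all $j\in\mathbb{Z}$ $$\|\triangle_j(fg)\|_{L^2}\le C\,c_j\,\omega(2^j)^{-1}2^{-(s+\bar s-d/2)j}\Big(\Gamma_1(2^j)\,\pi^{s,\bar s}_{\omega_1,\tilde\omega_1}(f,g)+\Gamma_2(2^j)\,\pi^{\bar s,s}_{\omega_2,\tilde\omega_2}(g,f)+\Gamma_3(2^j)\,\rho^{s,\bar s}_{\omega_3,\tilde\omega_3}(f,g)\Big).$$ (ii) With $\Gamma=\max\{\Gamma_1,\Gamma_2,\Gamma_3\}$, $$\|fg\|_{\dot H^{s+\bar s-d/2}_{\omega\Gamma^{-1}}}\le C\Big(\pi^{s,\bar s}_{\omega_1,\tilde\omega_1}(f,g)+\pi^{\bar s,s}_{\omega_2,\tilde\omega_2}(g,f)+\rho^{s,\bar s}_{\omega_3,\tilde\omega_3}(f,g)\Big),$$ and in particular the Fourier transform of $fg$ is locally integrable. -/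

import Mathlib

open MeasureTheory Filter Topology Set FourierTransform
open scoped SchwartzMap ENNReal

noncomputable section

namespace WeightedProduct

/-- Euclidean space `ℝ^d`. -/
abbrev E (d : ℕ) := EuclideanSpace ℝ (Fin d)

/-! ### Frequency weights -/

/-- The structural properties of a basic weight, for a function `w` on `[0, ∞)`: it is positive, `C^1`
and nondecreasing, satisfies `r w'(r) ≤ C w(r)`, and `w(r₁ r₂) ≤ C (w(r₁) + w(r₂))`.
Only the values of `w` on `[0, ∞)` matter. -/
structure IsBasicWeight (w : ℝ → ℝ) : Prop where
  contDiffOn : ContDiffOn ℝ 1 w (Ici 0)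
  pos : ∀ r, 0 ≤ r → 0 < w r
  deriv_nonneg : ∀ r, 0 ≤ r → 0 ≤ derivWithin w (Ici 0) r
  mul_deriv_le : ∃ C : ℝ, 0 < C ∧ ∀ r, 0 ≤ r → r * derivWithin w (Ici 0) r ≤ C * w r
  map_mul_le : ∃ C : ℝ, 0 < C ∧ ∀ r₁ r₂, 0 ≤ r₁ → 0 ≤ r₂ → w (r₁ * r₂) ≤ C * (w r₁ + w r₂)

/-- The class `𝓜_W`: quotients of two basic weights. -/
def IsWeight (w : ℝ → ℝ) : Prop :=
  ∃ a b : ℝ → ℝ, IsBasicWeight a ∧ IsBasicWeight b ∧ ∀ r, 0 ≤ r → w r = a r / b r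

/-! ### Weighted Sobolev norms -/

/-- `F` is the Fourier transform of the tempered distribution `f`, and `F ∈ L^1_loc(ℝ^d)`.
(Equality of distributions is tested on compactly supported smooth functions, against which every
locally integrable function can be integrated; such functions are dense in the Schwartz space.) -/
def IsFourierDensity {d : ℕ} (f : 𝓢'(E d, ℂ)) (F : E d → ℂ) : Prop :=
  LocallyIntegrable F volume ∧
    ∀ φ : 𝓢(E d, ℂ), HasCompactSupport φ → (𝓕 f) φ = ∫ ξ, φ ξ * F ξ

/-- The locally integrable density of `𝓕 f` is unique almost everywhere. -/
theorem IsFourierDensity.ae_eq {d : ℕ} {f : 𝓢'(E d, ℂ)} {F G : E d → ℂ}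
    (hF : IsFourierDensity f F) (hG : IsFourierDensity f G) : F =ᵐ[volume] G := by
  apply ae_eq_of_integral_contDiff_smul_eq hF.1 hG.1
  intro g g_smooth g_cpt
  have hg₁ : HasCompactSupport (Complex.ofRealCLM ∘ g) := g_cpt.comp_left rfl
  have hg₂ : ContDiff ℝ (⊤ : ℕ∞) (Complex.ofRealCLM ∘ g) := by fun_prop
  have h₁ := hF.2 (hg₁.toSchwartzMap hg₂) hg₁
  have h₂ := hG.2 (hg₁.toSchwartzMap hg₂) hg₁
  have h := h₁.symm.trans h₂
  simpa using h

/-- The norm of `Ḣ^σ_w(ℝ^d)`, that is, `‖Λ^σ w(D) f‖_{L²} = ‖ |ξ|^σ w(|ξ|) f̂(ξ) ‖_{L²}`; it is `∞`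
if `f̂` is not a locally integrable function. (The infimum runs over the densities of `f̂`, which
all agree almost everywhere.) Thus `f ∈ Ḣ^σ_w` if and only if this is finite. -/
def homNorm {d : ℕ} (σ : ℝ) (w : ℝ → ℝ) (f : 𝓢'(E d, ℂ)) : ℝ≥0∞ :=
  ⨅ (F : E d → ℂ) (_ : IsFourierDensity f F),
    eLpNorm (fun ξ => ((‖ξ‖ ^ σ * w ‖ξ‖ : ℝ) : ℂ) * F ξ) 2 volume

/-- The norm of `H^σ_w(ℝ^d)`, that is,
`‖(I - Δ)^{σ/2} w(D) f‖_{L²} = ‖ (1 + |ξ|²)^{σ/2} w(|ξ|) f̂(ξ) ‖_{L²}`; it is `∞` if `f̂` is not a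
locally integrable function. -/
def inhomNorm {d : ℕ} (σ : ℝ) (w : ℝ → ℝ) (f : 𝓢'(E d, ℂ)) : ℝ≥0∞ :=
  ⨅ (F : E d → ℂ) (_ : IsFourierDensity f F),
    eLpNorm (fun ξ => (((1 + ‖ξ‖ ^ 2) ^ (σ / 2) * w ‖ξ‖ : ℝ) : ℂ) * F ξ) 2 volume

theorem homNorm_eq {d : ℕ} (σ : ℝ) (w : ℝ → ℝ) {f : 𝓢'(E d, ℂ)} {F : E d → ℂ}
    (hF : IsFourierDensity f F) :
    homNorm σ w f = eLpNorm (fun ξ => ((‖ξ‖ ^ σ * w ‖ξ‖ : ℝ) : ℂ) * F ξ) 2 volume := by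
  refine le_antisymm (iInf₂_le F hF) (le_iInf₂ fun G hG => le_of_eq ?_)
  refine eLpNorm_congr_ae ?_
  filter_upwards [hF.ae_eq hG] with ξ h
  rw [h]

theorem inhomNorm_eq {d : ℕ} (σ : ℝ) (w : ℝ → ℝ) {f : 𝓢'(E d, ℂ)} {F : E d → ℂ}
    (hF : IsFourierDensity f F) :
    inhomNorm σ w f =
      eLpNorm (fun ξ => (((1 + ‖ξ‖ ^ 2) ^ (σ / 2) * w ‖ξ‖ : ℝ) : ℂ) * F ξ) 2 volume := by
  refine le_antisymm (iInf₂_le F hF) (le_iInf₂ fun G hG => le_of_eq ?_)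
  refine eLpNorm_congr_ae ?_
  filter_upwards [hF.ae_eq hG] with ξ h
  rw [h]

/-- `‖f‖_{Ḣ^r_ϱ}` if `r < d/2`, and `‖f‖_{H^r_ϱ}` if `r = d/2` (only used for `r ≤ d/2`). -/
def lowNorm {d : ℕ} (r : ℝ) (ϱ : ℝ → ℝ) (f : 𝓢'(E d, ℂ)) : ℝ≥0∞ :=
  if r < (d : ℝ) / 2 then homNorm r ϱ f else inhomNorm r ϱ f

/-- The quantity `π^{r,t}_{ϱ,ϱ'}(f, g)`. -/
def piNorm {d : ℕ} (r t : ℝ) (ϱ ϱ' : ℝ → ℝ) (f g : 𝓢'(E d, ℂ)) : ℝ≥0∞ :=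
  lowNorm r ϱ f * homNorm t ϱ' g

/-- The quantity `ρ^{r,t}_{ϱ,ϱ'}(f, g)`. -/
def rhoNorm {d : ℕ} (r t : ℝ) (ϱ ϱ' : ℝ → ℝ) (f g : 𝓢'(E d, ℂ)) : ℝ≥0∞ :=
  homNorm r ϱ f * homNorm t ϱ' g

/-- The integral
`1_{s < d/2} ∫_0^1 r^{d-2s-1} / w(yr)² dr + 1_{s ≥ d/2} ∫_0^y r^{d-1} / ((1+r²)^{d/2} w(r)²) dr`. -/
def lowIntegral (d : ℕ) (s : ℝ) (w : ℝ → ℝ) (y : ℝ) : ℝ :=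
  if s < (d : ℝ) / 2 then ∫ r in (0 : ℝ)..1, r ^ ((d : ℝ) - 2 * s - 1) / w (y * r) ^ 2
  else ∫ r in (0 : ℝ)..y,
    r ^ ((d : ℝ) - 1) / ((1 + r ^ 2) ^ ((d : ℝ) / 2) * w r ^ 2)

/-! ### Littlewood-Paley blocks -/

/-- `φ` generates a dyadic partition of unity: a smooth nonnegative radial function supported in the
annulus `1/2 < |ξ| < 2` with `∑_{j ∈ ℤ} φ(2^{-j} ξ) = 1` for `ξ ≠ 0`. (The corresponding
low-frequency cutoff is `1 - ∑_{j ≥ 0} φ(2^{-j} ·)`.) -/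
structure IsDyadicGenerator {d : ℕ} (φ : 𝓢(E d, ℝ)) : Prop where
  nonneg : ∀ ξ, 0 ≤ φ ξ
  radial : ∀ ξ η, ‖ξ‖ = ‖η‖ → φ ξ = φ η
  tsupport_subset : tsupport φ ⊆ {ξ | 1 / 2 < ‖ξ‖ ∧ ‖ξ‖ < 2}
  hasSum_one : ∀ ξ, ξ ≠ 0 → HasSum (fun j : ℤ => φ ((2 : ℝ) ^ (-j) • ξ)) 1

/-- The symbol `φ_j(ξ) = φ(2^{-j} ξ)`. -/
def dyadicSymbol {d : ℕ} (φ : 𝓢(E d, ℝ)) (j : ℤ) (ξ : E d) : ℂ :=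
  (φ ((2 : ℝ) ^ (-j) • ξ) : ℂ)

theorem dyadicSymbol_hasTemperateGrowth {d : ℕ} (φ : 𝓢(E d, ℝ)) (j : ℤ) :
    (dyadicSymbol φ j).HasTemperateGrowth := by
  have h1 : (fun ξ : E d => (2 : ℝ) ^ (-j) • ξ).HasTemperateGrowth :=
    ((2 : ℝ) ^ (-j) • ContinuousLinearMap.id ℝ (E d)).hasTemperateGrowth
  have h2 : (fun ξ : E d => φ ((2 : ℝ) ^ (-j) • ξ)).HasTemperateGrowth :=
    φ.hasTemperateGrowth.comp h1
  exact Complex.ofRealCLM.hasTemperateGrowth.comp h2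

/-- The homogeneous Littlewood-Paley block `Δ_j`, `𝓕(Δ_j f) = φ_j 𝓕 f`. -/
def lpBlock {d : ℕ} (φ : 𝓢(E d, ℝ)) (j : ℤ) (f : 𝓢'(E d, ℂ)) : 𝓢'(E d, ℂ) :=
  TemperedDistribution.fourierMultiplierCLM ℂ (dyadicSymbol φ j) f

/-- The `L²` norm of a tempered distribution, `∞` if it is not an `L²` function. -/
def l2Norm {d : ℕ} (u : 𝓢'(E d, ℂ)) : ℝ≥0∞ :=
  ⨅ (v : Lp ℂ 2 (volume : Measure (E d))) (_ : Lp.toTemperedDistribution v = u), ‖v‖ₑ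

/-! ### Products of distributions -/

/-- For a compactly supported cutoff `χ` and `F = f̂`, the function
`S_n f = 𝓕⁻¹(χ(2^{-n} ·) f̂)`, i.e. `f` with its high frequencies removed. -/
def lowPass {d : ℕ} (χ F : E d → ℂ) (n : ℕ) (x : E d) : ℂ :=
  𝓕⁻ (fun ξ => χ (((2 : ℝ) ^ n)⁻¹ • ξ) * F ξ) x

/-- `h` is the product `fg` of two tempered distributions whose Fourier transforms are locally
integrable functions: for every smooth compactly supported cutoff `χ` which is `1` near the origin,
the pointwise products `(S_n f)(S_n g)` of the frequency-truncated functions converge to `h` in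
`𝓢'` as `n → ∞`. -/
def IsProduct {d : ℕ} (f g h : 𝓢'(E d, ℂ)) : Prop :=
  ∃ F G : E d → ℂ, IsFourierDensity f F ∧ IsFourierDensity g G ∧
    ∀ χ : E d → ℂ, ContDiff ℝ (⊤ : ℕ∞) χ → HasCompactSupport χ → χ =ᶠ[𝓝 0] 1 →
      ∀ ψ : 𝓢(E d, ℂ),
        Tendsto (fun n : ℕ => ∫ x, ψ x * (lowPass χ F n x * lowPass χ G n x)) atTop (𝓝 (h ψ))

end WeightedProduct

end

/-!
A product estimate in weighted Sobolev spaces, proved entirely on the Fourier side.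

If `F` and `G` are the densities of the Fourier transforms of `f` and `g`, then `F ⋆ G` is the
density of the Fourier transform of `fg`. The whole theorem follows from one pointwise bound on
the absolute convolution `∫ |F(ζ)| |G(ξ - ζ)| dζ` (`exists_convolution_bound`), and no paraproduct
decomposition of `f` and `g` is needed. The region of integration is covered by three pieces.

* On `|ζ| < |ξ| / 2` the weight of `g` at `ξ - ζ` is comparable with its value at `|ξ|`. The
  Cauchy-Schwarz inequality at fixed `ξ`, against the weight of `f`, leaves the factor
  `∫_{|ζ| < y} p(|ζ|)^{-2} dζ`, where `p` is that weight; in polar coordinates this is exactly the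
  integral in the hypothesis on `Γ₁` (`lintegral_lowWeight`, `lowHigh_bound`). The other factor is
  a convolution of two integrable functions, hence integrable in `ξ`.
* On `|ξ - ζ| < |ξ| / 2` the roles of `f` and `g` are exchanged.
* Elsewhere `|ζ|` and `|ξ - ζ|` are comparable and at least `|ξ| / 2`. A weight grows or decays
  more slowly than every power (`IsBasicWeight.le_mul_rpow`), so replacing the weights at `ζ` and
  `ξ - ζ` by those at `ξ` gains a power `(|ξ| / |ζ|)^ε`, with `2 ε = s + s' > 0`
  (`weight_mul_weight_le`). This makes the remaining homogeneous kernel integrable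
  (`highHigh_bound`, `lintegral_highHighDensity_le`).

Thus for every `y` comparable with `|ξ|` the quantity `(y^{s+s'-d/2} ω(y) |F ⋆ G(ξ)|)²` is at most
a constant times `∑ᵢ Γᵢ(y)² Aᵢ(ξ)`, where `∫ Aᵢ` is at most a constant times the square of the
`i`-th product of norms. Taking `y = 2^j` and integrating over the annulus `|ξ| ~ 2^j` gives the
dyadic estimate: the masses of the `Aᵢ` on the annuli are summable, because the annuli overlap at
most twice, and their normalised average is `c_j²` (`exists_annulus_bound`). Taking `y = |ξ|` and
integrating over all `ξ` gives the norm estimate (`lintegral_weighted_conv_le`).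

The product exists because the double integral of `(1 + |ζ + η|²)^{-N} |F(ζ)| |G(η)|` is finite
for large `N` (`exists_integrable_decay_mul`): where `ζ` and `η` are not comparable there is no
cancellation in `ζ + η`, and where they are comparable and large, `s + s' > 0` bounds
`|F(ζ)| |G(η)|` by the sum of the weighted squares. Hence `F ⋆ G` is the Fourier transform of a
tempered distribution, and the products of the frequency truncations converge to it by dominated
convergence (`isProduct_of_fourier_apply`).
-/

open MeasureTheory Filter Topology Set FourierTransform
open scoped SchwartzMap ENNReal

noncomputable section

namespace WeightedProduct

/-! ### Growth of the weights -/

theorem IsBasicWeight.monotoneOn {w : ℝ → ℝ} (hw : IsBasicWeight w) : MonotoneOn w (Ici 0) := by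
  refine monotoneOn_of_deriv_nonneg (convex_Ici 0) hw.contDiffOn.continuousOn ?_ ?_
  · exact (hw.contDiffOn.differentiableOn one_ne_zero).mono interior_subset
  · intro x hx
    rw [← derivWithin_of_mem_nhds (mem_interior_iff_mem_nhds.1 hx)]
    exact hw.deriv_nonneg x (interior_subset hx)

/-- Basic weights grow more slowly than every power. By the quasi-subadditivity
`w (λ x) ≤ C (w λ + w x)`, a dilation by `λ` multiplies `w` by at most `2 C` on `[λ, ∞)`,
whatever `λ` is; it suffices to take `λ` so large that `2 C ≤ λ ^ δ`. -/
theorem IsBasicWeight.le_mul_rpow {w : ℝ → ℝ} (hw : IsBasicWeight w) {δ : ℝ} (hδ : 0 < δ) :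
    ∃ M : ℝ, 0 < M ∧ ∀ x, 1 ≤ x → w x ≤ M * x ^ δ := by
  obtain ⟨C, hC, hmul⟩ := hw.map_mul_le
  obtain ⟨l, hl, hl1⟩ :=
    (((tendsto_rpow_atTop hδ).eventually_ge_atTop (2 * C)).and (eventually_gt_atTop 1)).exists
  have hl0 : 0 < l := one_pos.trans hl1
  have key : ∀ n : ℕ, ∀ x, 1 ≤ x → x ≤ l ^ n * l ^ 2 → w x ≤ w (l ^ 2) * x ^ δ := by
    intro n
    induction n with
    | zero =>
      intro x hx hxl
      have h1 : w x ≤ w (l ^ 2) :=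
        hw.monotoneOn (mem_Ici.2 (by linarith)) (mem_Ici.2 (by positivity)) (by simpa using hxl)
      exact h1.trans (le_mul_of_one_le_right (hw.pos _ (by positivity)).le
        (Real.one_le_rpow hx hδ.le))
    | succ n ih =>
      intro x hx hxl
      rcases le_total x (l ^ 2) with h | h
      · have h1 : w x ≤ w (l ^ 2) :=
          hw.monotoneOn (mem_Ici.2 (by linarith)) (mem_Ici.2 (by positivity)) h
        exact h1.trans (le_mul_of_one_le_right (hw.pos _ (by positivity)).le
          (Real.one_le_rpow hx hδ.le))
      · have hlx : l ≤ x / l := by rw [le_div_iff₀ hl0]; nlinarith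
        have h1 : w (x / l) ≤ w (l ^ 2) * (x / l) ^ δ := by
          refine ih _ (hl1.le.trans hlx) ?_
          rw [div_le_iff₀ hl0]
          calc x ≤ l ^ (n + 1) * l ^ 2 := hxl
            _ = _ := by ring
        have h2 : w l ≤ w (x / l) :=
          hw.monotoneOn (mem_Ici.2 hl0.le) (mem_Ici.2 (by positivity)) hlx
        have h3 : w x ≤ C * (w l + w (x / l)) := by
          have := hmul l (x / l) hl0.le (by positivity)
          rwa [mul_div_cancel₀ _ hl0.ne'] at this
        have h4 : 0 ≤ w (x / l) := (hw.pos _ (by positivity)).le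
        calc w x ≤ 2 * C * w (x / l) := by nlinarith
          _ ≤ l ^ δ * (w (l ^ 2) * (x / l) ^ δ) := by gcongr
          _ = w (l ^ 2) * x ^ δ := by
            rw [Real.div_rpow (by linarith) hl0.le]
            field_simp
  refine ⟨w (l ^ 2), hw.pos _ (by positivity), fun x hx => ?_⟩
  obtain ⟨n, hn⟩ := pow_unbounded_of_one_lt x hl1
  exact key n x hx (hn.le.trans (le_mul_of_one_le_right (by positivity) (one_le_pow₀ hl1.le)))

theorem IsBasicWeight.dilation_le {w : ℝ → ℝ} (hw : IsBasicWeight w) {δ : ℝ} (hδ : 0 < δ) :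
    ∃ K : ℝ, 0 < K ∧ ∀ r t, 0 ≤ r → 1 ≤ t → w (t * r) ≤ K * t ^ δ * w r := by
  obtain ⟨C, hC, hmul⟩ := hw.map_mul_le
  obtain ⟨M, hM, hle⟩ := hw.le_mul_rpow hδ
  have h0 : 0 < w 0 := hw.pos 0 le_rfl
  refine ⟨C * (M / w 0 + 1), by positivity, fun r t hr ht => ?_⟩
  have h0r : w 0 ≤ w r := hw.monotoneOn (mem_Ici.2 le_rfl) (mem_Ici.2 hr) hr
  have htδ : 1 ≤ t ^ δ := Real.one_le_rpow ht hδ.le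
  have h1 : w t ≤ M / w 0 * t ^ δ * w r := by
    calc w t ≤ M * t ^ δ := hle t ht
      _ = M / w 0 * t ^ δ * w 0 := by field_simp
      _ ≤ _ := by gcongr
  have h2 : w r ≤ t ^ δ * w r := le_mul_of_one_le_left (hw.pos r hr).le htδ
  calc w (t * r) ≤ C * (w t + w r) := hmul t r (by linarith) hr
    _ ≤ C * (M / w 0 * t ^ δ * w r + t ^ δ * w r) := by gcongr
    _ = _ := by ring

theorem IsBasicWeight.le_dilation {w : ℝ → ℝ} (hw : IsBasicWeight w) {r t : ℝ} (hr : 0 ≤ r)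
    (ht : 1 ≤ t) : w r ≤ w (t * r) :=
  hw.monotoneOn (mem_Ici.2 hr) (mem_Ici.2 (by positivity)) (le_mul_of_one_le_left hr ht)

theorem IsWeight.pos {w : ℝ → ℝ} (hw : IsWeight w) {r : ℝ} (hr : 0 ≤ r) : 0 < w r := by
  obtain ⟨a, b, ha, hb, h⟩ := hw
  rw [h r hr]
  exact div_pos (ha.pos r hr) (hb.pos r hr)

theorem IsWeight.continuousOn {w : ℝ → ℝ} (hw : IsWeight w) : ContinuousOn w (Ici 0) := by
  obtain ⟨a, b, ha, hb, h⟩ := hw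
  exact (ha.contDiffOn.continuousOn.div hb.contDiffOn.continuousOn
    fun r hr => (hb.pos r hr).ne').congr fun r hr => h r hr

theorem IsWeight.continuous_comp_norm {V : Type*} [SeminormedAddCommGroup V] {w : ℝ → ℝ}
    (hw : IsWeight w) : Continuous fun ξ : V => w ‖ξ‖ :=
  hw.continuousOn.comp_continuous continuous_norm fun ξ => mem_Ici.2 (norm_nonneg ξ)

/-- A weight changes at most by a factor `K t ^ δ` when its argument changes at most by a
factor `t`; here `δ > 0` is arbitrary. -/
theorem IsWeight.le_mul_of_comparable {w : ℝ → ℝ} (hw : IsWeight w) {δ : ℝ} (hδ : 0 < δ) :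
    ∃ K : ℝ, 0 < K ∧ ∀ r x t, 0 < r → 0 < x → r ≤ t * x → x ≤ t * r →
      w r ≤ K * t ^ δ * w x := by
  obtain ⟨a, b, ha, hb, h⟩ := hw
  obtain ⟨A, hA, hA'⟩ := ha.dilation_le hδ
  obtain ⟨B, hB, hB'⟩ := hb.dilation_le hδ
  refine ⟨A + B, by positivity, fun r x t hr hx hrx hxr => ?_⟩
  rw [h r hr.le, h x hx.le, ← mul_div_assoc,
    div_le_div_iff₀ (hb.pos r hr.le) (hb.pos x hx.le)]
  have har := ha.pos r hr.le
  have hax := ha.pos x hx.le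
  have hbr := hb.pos r hr.le
  have hbx := hb.pos x hx.le
  rcases le_total x r with hle | hle
  · have h1 : 1 ≤ r / x := (one_le_div hx).2 hle
    have h2 : r / x ≤ t := (div_le_iff₀ hx).2 hrx
    have e : r / x * x = r := div_mul_cancel₀ _ hx.ne'
    have h3 := hA' x (r / x) hx.le h1
    have h4 := hb.le_dilation hx.le h1
    rw [e] at h3 h4
    calc a r * b x ≤ (A * (r / x) ^ δ * a x) * b r := by gcongr
      _ ≤ ((A + B) * t ^ δ * a x) * b r := by gcongr; linarith
  · have h1 : 1 ≤ x / r := (one_le_div hr).2 hle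
    have h2 : x / r ≤ t := (div_le_iff₀ hr).2 hxr
    have e : x / r * r = x := div_mul_cancel₀ _ hr.ne'
    have h3 := hB' r (x / r) hr.le h1
    have h4 := ha.le_dilation hr.le h1
    rw [e] at h3 h4
    calc a r * b x ≤ a x * (B * (x / r) ^ δ * b r) := by gcongr
      _ ≤ a x * ((A + B) * t ^ δ * b r) := by gcongr; linarith
      _ = ((A + B) * t ^ δ * a x) * b r := by ring

/-! ### Radial integrals -/

/-- The surface measure `d |B(0, 1)|` of the unit sphere of `ℝ^d`. -/
def sphereArea (d : ℕ) : ℝ := d * volume.real (Metric.ball (0 : E d) 1)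

theorem sphereArea_nonneg (d : ℕ) : 0 ≤ sphereArea d := by
  unfold sphereArea
  positivity

theorem lintegral_ball_norm {d : ℕ} (hd : 1 ≤ d) {f : ℝ → ℝ} (hf : ∀ r, 0 ≤ r → 0 ≤ f r) {y : ℝ}
    (hy : 0 < y) (hint : IntegrableOn (fun r => r ^ (d - 1) * f r) (Ioo 0 y)) :
    ∫⁻ ζ in Metric.ball (0 : E d) y, ENNReal.ofReal (f ‖ζ‖) =
      ENNReal.ofReal (sphereArea d * ∫ r in (0 : ℝ)..y, r ^ (d - 1) * f r) := by
  have : Nonempty (Fin d) := ⟨⟨0, hd⟩⟩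
  have hdim : Module.finrank ℝ (E d) = d := by simp
  have hint' : IntegrableOn (fun ζ : E d => f ‖ζ‖) (Metric.ball 0 y) := by
    rw [integrableOn_fun_norm_addHaar, hdim]
    simpa only [smul_eq_mul] using hint
  rw [← ofReal_integral_eq_lintegral_ofReal hint' (ae_of_all _ fun ζ => hf _ (norm_nonneg ζ))]
  congr 1
  have h1 : ∫ ζ in Metric.ball (0 : E d) y, f ‖ζ‖ = ∫ ζ : E d, (Iio y).indicator f ‖ζ‖ := by
    rw [← integral_indicator measurableSet_ball]
    refine integral_congr_ae (ae_of_all _ fun ζ => ?_)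
    simp [indicator]
  rw [h1, integral_fun_norm_addHaar, hdim, sphereArea, nsmul_eq_mul, smul_eq_mul, mul_assoc]
  congr 2
  rw [intervalIntegral.integral_of_le hy.le, integral_Ioc_eq_integral_Ioo,
    ← integral_indicator measurableSet_Ioi, ← integral_indicator measurableSet_Ioo]
  refine integral_congr_ae (ae_of_all _ fun r => ?_)
  by_cases h0 : 0 < r <;> by_cases h1 : r < y <;> simp [indicator, h0, h1]

/-- The Fourier weight of `lowNorm`. -/
def lowWeight (d : ℕ) (s : ℝ) (w : ℝ → ℝ) (r : ℝ) : ℝ :=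
  if s < (d : ℝ) / 2 then r ^ s * w r else (1 + r ^ 2) ^ (s / 2) * w r

theorem lowWeight_pos {d : ℕ} {s : ℝ} {w : ℝ → ℝ} (hw : IsWeight w) {r : ℝ} (hr : 0 < r) :
    0 < lowWeight d s w r := by
  have := hw.pos hr.le
  unfold lowWeight
  split_ifs <;> positivity

theorem measurable_rpow_mul_weight {d : ℕ} {w : ℝ → ℝ} (hw : IsWeight w) (s : ℝ) :
    Measurable fun ζ : E d => ‖ζ‖ ^ s * w ‖ζ‖ :=
  (measurable_norm.pow_const s).mul hw.continuous_comp_norm.measurable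

theorem measurable_lowWeight {d : ℕ} {w : ℝ → ℝ} (hw : IsWeight w) (s : ℝ) :
    Measurable fun ζ : E d => lowWeight d s w ‖ζ‖ := by
  unfold lowWeight
  split_ifs
  · exact measurable_rpow_mul_weight hw s
  · exact (((measurable_norm.pow_const 2).const_add 1).pow_const _).mul
      hw.continuous_comp_norm.measurable

/-- The square of the best constant in `‖f̂‖_{L¹(B(0, y))} ≤ C ‖f‖`, for the norm `lowNorm s w`. -/
theorem lintegral_lowWeight {d : ℕ} (hd : 1 ≤ d) {s : ℝ} (hs : s ≤ (d : ℝ) / 2) {w : ℝ → ℝ}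
    (hw : IsWeight w) {y : ℝ} (hy : 0 < y) :
    ∫⁻ ζ in Metric.ball (0 : E d) y, ENNReal.ofReal ((lowWeight d s w ‖ζ‖ ^ 2)⁻¹) =
      ENNReal.ofReal (sphereArea d * (y ^ ((d : ℝ) - 2 * s) * lowIntegral d s w y)) := by
  have hwc : ContinuousOn (fun r => (w r ^ 2)⁻¹) (uIcc 0 y) := by
    rw [uIcc_of_le hy.le]
    refine ((hw.continuousOn.mono fun r hr => hr.1).pow 2).inv₀ fun r hr => ?_
    exact pow_ne_zero 2 (hw.pos hr.1).ne'
  have hpow : ∀ r : ℝ, 0 < r → r ^ (d - 1) = r ^ ((d : ℝ) - 1) := by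
    intro r hr
    rw [← Real.rpow_natCast, Nat.cast_sub hd, Nat.cast_one]
  by_cases h : s < (d : ℝ) / 2
  · have e : ∀ r, 0 < r → r ^ (d - 1) * (lowWeight d s w r ^ 2)⁻¹ =
        r ^ ((d : ℝ) - 2 * s - 1) * (w r ^ 2)⁻¹ := by
      intro r hr
      have e2 : r ^ ((d : ℝ) - 2 * s - 1) = r ^ ((d : ℝ) - 1) * ((r ^ s) ^ 2)⁻¹ := by
        rw [← Real.rpow_natCast (r ^ s), ← Real.rpow_mul hr.le, ← Real.rpow_neg hr.le,
          ← Real.rpow_add hr]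
        congr 1
        push_cast
        ring
      rw [lowWeight, if_pos h, hpow r hr, e2, mul_pow, mul_inv]
      ring
    have hi : IntervalIntegrable (fun r => r ^ ((d : ℝ) - 2 * s - 1) * (w r ^ 2)⁻¹) volume 0 y :=
      (intervalIntegral.intervalIntegrable_rpow' (by linarith)).mul_continuousOn hwc
    rw [lintegral_ball_norm hd (f := fun r => (lowWeight d s w r ^ 2)⁻¹)
      (fun r _ => by positivity) hy]
    · congr 2
      rw [lowIntegral, if_pos h]
      have e3 : ∫ r in (0 : ℝ)..y, r ^ (d - 1) * (lowWeight d s w r ^ 2)⁻¹ =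
          ∫ r in (0 : ℝ)..y, r ^ ((d : ℝ) - 2 * s - 1) * (w r ^ 2)⁻¹ := by
        rw [intervalIntegral.integral_of_le hy.le, intervalIntegral.integral_of_le hy.le]
        exact setIntegral_congr_fun measurableSet_Ioc fun r hr => e r hr.1
      rw [e3]
      have e4 := intervalIntegral.mul_integral_comp_mul_left (a := 0) (b := 1)
        (f := fun r => r ^ ((d : ℝ) - 2 * s - 1) * (w r ^ 2)⁻¹) y
      rw [mul_zero, mul_one] at e4
      rw [← e4, ← intervalIntegral.integral_const_mul, ← intervalIntegral.integral_const_mul,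
        intervalIntegral.integral_of_le zero_le_one, intervalIntegral.integral_of_le zero_le_one]
      refine setIntegral_congr_fun measurableSet_Ioc fun r hr => ?_
      have hr0 : 0 < r := hr.1
      have e5 : y ^ ((d : ℝ) - 2 * s) = y * y ^ ((d : ℝ) - 2 * s - 1) := by
        rw [Real.rpow_sub_one hy.ne']
        field_simp
      simp only [Real.mul_rpow hy.le hr0.le, e5, div_eq_mul_inv]
      ring
    · refine IntegrableOn.congr_fun ?_ (fun r hr => (e r hr.1).symm) measurableSet_Ioo
      rw [intervalIntegrable_iff_integrableOn_Ioc_of_le hy.le] at hi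
      exact hi.mono_set Ioo_subset_Ioc_self
  · have hsd : s = (d : ℝ) / 2 := le_antisymm hs (not_lt.1 h)
    have e : ∀ r, 0 < r → r ^ (d - 1) * (lowWeight d s w r ^ 2)⁻¹ =
        r ^ ((d : ℝ) - 1) / ((1 + r ^ 2) ^ ((d : ℝ) / 2) * w r ^ 2) := by
      intro r hr
      have e2 : (1 + r ^ 2) ^ ((d : ℝ) / 2) = ((1 + r ^ 2) ^ (s / 2)) ^ 2 := by
        rw [← Real.rpow_natCast ((1 + r ^ 2) ^ (s / 2)), ← Real.rpow_mul (by positivity), hsd]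
        congr 1
        push_cast
        ring
      rw [lowWeight, if_neg h, hpow r hr, e2, mul_pow, ← div_eq_mul_inv]
    have hi : IntervalIntegrable (fun r => r ^ ((d : ℝ) - 1) *
        (((1 + r ^ 2) ^ ((d : ℝ) / 2))⁻¹ * (w r ^ 2)⁻¹)) volume 0 y := by
      have hd' : (1 : ℝ) ≤ d := by exact_mod_cast hd
      refine (intervalIntegral.intervalIntegrable_rpow' (by linarith)).mul_continuousOn
        (ContinuousOn.mul ?_ hwc)
      refine Continuous.continuousOn (Continuous.inv₀ ?_ fun r => ?_)
      · exact (by fun_prop : Continuous fun r : ℝ => 1 + r ^ 2).rpow_const fun r =>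
          Or.inl (by positivity)
      · positivity
    rw [lintegral_ball_norm hd (f := fun r => (lowWeight d s w r ^ 2)⁻¹)
      (fun r _ => by positivity) hy]
    · congr 2
      have e0 : (d : ℝ) - 2 * s = 0 := by rw [hsd]; ring
      rw [lowIntegral, if_neg h, e0, Real.rpow_zero, one_mul,
        intervalIntegral.integral_of_le hy.le, intervalIntegral.integral_of_le hy.le]
      exact setIntegral_congr_fun measurableSet_Ioc fun r hr => e r hr.1
    · refine IntegrableOn.congr_fun ?_ (fun r hr => (e r hr.1).symm) measurableSet_Ioo
      rw [intervalIntegrable_iff_integrableOn_Ioc_of_le hy.le] at hi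
      refine (hi.mono_set Ioo_subset_Ioc_self).congr_fun (fun r _ => ?_) measurableSet_Ioo
      simp only [div_eq_mul_inv, mul_inv]

theorem lowIntegral_nonneg {d : ℕ} {s : ℝ} {w : ℝ → ℝ} {y : ℝ} (hy : 0 ≤ y) :
    0 ≤ lowIntegral d s w y := by
  unfold lowIntegral
  split_ifs
  · refine intervalIntegral.integral_nonneg zero_le_one fun r hr => ?_
    have := hr.1
    positivity
  · refine intervalIntegral.integral_nonneg hy fun r hr => ?_
    have := hr.1
    positivity

/-- Near the origin, `|ξ| ^ (a - d)` is integrable for `a > 0`. -/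
theorem lintegral_ball_norm_rpow {d : ℕ} (hd : 1 ≤ d) {a : ℝ} (ha : 0 < a) {y : ℝ} (hy : 0 < y) :
    ∫⁻ ζ in Metric.ball (0 : E d) y, ENNReal.ofReal (‖ζ‖ ^ (a - d)) =
      ENNReal.ofReal (sphereArea d * (y ^ a / a)) := by
  have e : ∀ r : ℝ, 0 < r → r ^ (d - 1) * r ^ (a - d) = r ^ (a - 1) := by
    intro r hr
    rw [← Real.rpow_natCast, Nat.cast_sub hd, Nat.cast_one, ← Real.rpow_add hr]
    congr 1
    ring
  rw [lintegral_ball_norm hd (f := fun r => r ^ (a - d)) (fun r hr => by positivity) hy]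
  · congr 2
    have e2 : ∫ r in (0 : ℝ)..y, r ^ (d - 1) * r ^ (a - d) = ∫ r in (0 : ℝ)..y, r ^ (a - 1) := by
      rw [intervalIntegral.integral_of_le hy.le, intervalIntegral.integral_of_le hy.le]
      exact setIntegral_congr_fun measurableSet_Ioc fun r hr => e r hr.1
    rw [e2, integral_rpow (Or.inl (by linarith)), sub_add_cancel, Real.zero_rpow ha.ne', sub_zero]
  · refine IntegrableOn.congr_fun ?_ (fun r hr => (e r hr.1).symm) measurableSet_Ioo
    have hi : IntervalIntegrable (fun r : ℝ => r ^ (a - 1)) volume 0 y :=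
      intervalIntegral.intervalIntegrable_rpow' (by linarith)
    rw [intervalIntegrable_iff_integrableOn_Ioc_of_le hy.le] at hi
    exact hi.mono_set Ioo_subset_Ioc_self

/-! ### Bilinear estimates on the Fourier side -/

theorem sq_lintegral_mul_le {α : Type*} [MeasurableSpace α] (μ : Measure α) {f g : α → ℝ≥0∞}
    (hf : AEMeasurable f μ) (hg : AEMeasurable g μ) :
    (∫⁻ a, f a * g a ∂μ) ^ 2 ≤ (∫⁻ a, f a ^ 2 ∂μ) * ∫⁻ a, g a ^ 2 ∂μ := by
  have h := ENNReal.lintegral_mul_le_Lp_mul_Lq μ Real.HolderConjugate.two_two hf hg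
  simp only [Pi.mul_apply, ENNReal.rpow_ofNat] at h
  calc (∫⁻ a, f a * g a ∂μ) ^ 2
      ≤ ((∫⁻ a, f a ^ 2 ∂μ) ^ (1 / 2 : ℝ) * (∫⁻ a, g a ^ 2 ∂μ) ^ (1 / 2 : ℝ)) ^ 2 := by gcongr
    _ = _ := by
      rw [mul_pow, ← ENNReal.rpow_mul_natCast, ← ENNReal.rpow_mul_natCast]
      norm_num

theorem add_three_sq_le (a b c : ℝ≥0∞) : (a + b + c) ^ 2 ≤ 9 * (a ^ 2 + b ^ 2 + c ^ 2) := by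
  have key : ∀ m : ℝ≥0∞, a ≤ m → b ≤ m → c ≤ m → m ^ 2 ≤ a ^ 2 + b ^ 2 + c ^ 2 →
      (a + b + c) ^ 2 ≤ 9 * (a ^ 2 + b ^ 2 + c ^ 2) := by
    intro m ha hb hc hm
    calc (a + b + c) ^ 2 ≤ (m + m + m) ^ 2 := by gcongr
      _ = 9 * m ^ 2 := by ring
      _ ≤ _ := by gcongr
  rcases le_total a b with hab | hab
  · rcases le_total b c with hbc | hbc
    · exact key c (hab.trans hbc) hbc le_rfl le_add_self
    · exact key b hab le_rfl hbc (le_add_self.trans le_self_add)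
  · rcases le_total a c with hac | hac
    · exact key c hac (hab.trans hac) le_rfl le_add_self
    · exact key a le_rfl hab hac (le_self_add.trans le_self_add)

theorem ae_ne_zero {d : ℕ} (hd : 1 ≤ d) : ∀ᵐ ζ : E d, ζ ≠ 0 := by
  have : Nonempty (Fin d) := ⟨⟨0, hd⟩⟩
  exact compl_mem_ae_iff.2 (measure_singleton 0)

theorem lintegral_lintegral_mul_sub {d : ℕ} {a b : E d → ℝ≥0∞} (ha : Measurable a)
    (hb : Measurable b) :
    ∫⁻ ξ, ∫⁻ ζ, a ζ * b (ξ - ζ) = (∫⁻ ζ, a ζ) * ∫⁻ η, b η := by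
  have hm : Measurable fun x : E d × E d => a x.2 * b (x.1 - x.2) :=
    (ha.comp measurable_snd).mul (hb.comp (measurable_fst.sub measurable_snd))
  rw [lintegral_lintegral_swap hm.aemeasurable]
  have : ∀ ζ : E d, ∫⁻ ξ, a ζ * b (ξ - ζ) = a ζ * ∫⁻ η, b η := by
    intro ζ
    rw [lintegral_const_mul _ (by fun_prop : Measurable fun ξ : E d => b (ξ - ζ)),
      lintegral_sub_right_eq_self b]
  simp_rw [this]
  rw [lintegral_mul_const _ ha]

/-- `(p(|ζ|) F(ζ))²`, whose integral is the square of a weighted norm. -/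
def weightedSq {d : ℕ} (p : ℝ → ℝ) (F : E d → ℝ≥0∞) (ζ : E d) : ℝ≥0∞ :=
  (ENNReal.ofReal (p ‖ζ‖) * F ζ) ^ 2

theorem measurable_weightedSq {d : ℕ} {p : ℝ → ℝ} (hp : Measurable fun ζ : E d => p ‖ζ‖)
    {F : E d → ℝ≥0∞} (hF : Measurable F) : Measurable (weightedSq p F) :=
  (hp.ennreal_ofReal.mul hF).pow_const 2

theorem rpow_le_of_comparable {s r x t : ℝ} (hr : 0 < r) (hx : 0 < x) (ht : 1 ≤ t)
    (hrx : r ≤ t * x) (hxr : x ≤ t * r) : r ^ s ≤ t ^ |s| * x ^ s := by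
  have ht0 : 0 < t := by linarith
  rcases le_total 0 s with h | h
  · rw [abs_of_nonneg h, ← Real.mul_rpow ht0.le hx.le]
    exact Real.rpow_le_rpow hr.le hrx h
  · have h1 : t⁻¹ * x ≤ r := by
      rw [inv_mul_le_iff₀ ht0]
      exact hxr
    calc r ^ s ≤ (t⁻¹ * x) ^ s := Real.rpow_le_rpow_of_nonpos (by positivity) h1 h
      _ = t ^ |s| * x ^ s := by
        rw [Real.mul_rpow (by positivity) hx.le, Real.inv_rpow ht0.le, ← Real.rpow_neg ht0.le,
          abs_of_nonpos h]

theorem IsWeight.rpow_mul_le_of_comparable {w : ℝ → ℝ} (hw : IsWeight w) (s : ℝ) {t : ℝ}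
    (ht : 1 ≤ t) :
    ∃ K : ℝ, 0 < K ∧ ∀ r x, 0 < r → 0 < x → r ≤ t * x → x ≤ t * r →
      r ^ s * w r ≤ K * (x ^ s * w x) := by
  obtain ⟨K, hK, h⟩ := hw.le_mul_of_comparable one_pos
  have ht0 : 0 < t := by linarith
  refine ⟨t ^ |s| * (K * t ^ (1 : ℝ)), by positivity, fun r x hr hx hrx hxr => ?_⟩
  have h1 := h r x t hr hx hrx hxr
  have h2 := rpow_le_of_comparable (s := s) hr hx ht hrx hxr
  have h3 := hw.pos hr.le
  calc r ^ s * w r ≤ (t ^ |s| * x ^ s) * (K * t ^ (1 : ℝ) * w x) := by gcongr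
    _ = _ := by ring

theorem sq_mul_le_of_mul_le {x q L T R Z : ℝ≥0∞} (hT : q * T ≤ L * R) (hR : R ^ 2 ≤ Z) :
    (x * q * T) ^ 2 ≤ x ^ 2 * L ^ 2 * Z := by
  calc (x * q * T) ^ 2 = x ^ 2 * (q * T) ^ 2 := by ring
    _ ≤ x ^ 2 * (L * R) ^ 2 := by gcongr
    _ = x ^ 2 * L ^ 2 * R ^ 2 := by ring
    _ ≤ _ := by gcongr

/-- The interaction of the low frequencies of `f` with `g`. The Cauchy-Schwarz inequality is applied
pointwise in `ξ`, and its first factor is the integral in `lintegral_lowWeight`. -/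
theorem lowHigh_bound {d : ℕ} (hd : 1 ≤ d) {s s' : ℝ} (hs : s ≤ (d : ℝ) / 2)
    {ω w w' Γ : ℝ → ℝ} (hω : IsWeight ω) (hw : IsWeight w) (hw' : IsWeight w')
    (hΓ : ∀ y, 0 ≤ y → 0 ≤ Γ y) {C : ℝ}
    (hcond : ∀ y, 0 ≤ y → ω y / w' y * (lowIntegral d s w y) ^ ((1 : ℝ) / 2) ≤ C * Γ y) :
    ∃ K : ℝ, 0 ≤ K ∧ ∀ F G : E d → ℝ≥0∞, Measurable F → Measurable G →
      ∀ ξ : E d, ξ ≠ 0 → ∀ y : ℝ, 0 < y → ‖ξ‖ ≤ 2 * y → y ≤ 2 * ‖ξ‖ →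
        (ENNReal.ofReal (y ^ (s + s' - (d : ℝ) / 2) * ω y) *
            ∫⁻ ζ in Metric.ball 0 (‖ξ‖ / 2), F ζ * G (ξ - ζ)) ^ 2 ≤
          ENNReal.ofReal K * (ENNReal.ofReal (Γ y) ^ 2 *
            ∫⁻ ζ, weightedSq (lowWeight d s w) F ζ *
              weightedSq (fun r => r ^ s' * w' r) G (ξ - ζ)) := by
  obtain ⟨L, hL, hcomp⟩ := hw'.rpow_mul_le_of_comparable s' (t := 4) (by norm_num)
  refine ⟨L ^ 2 * sphereArea d * C ^ 2, mul_nonneg (mul_nonneg (by positivity)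
    (sphereArea_nonneg d)) (by positivity), fun F G hF hG ξ hξ y hy h1 h2 => ?_⟩
  have hξ' : 0 < ‖ξ‖ := norm_pos_iff.2 hξ
  set p : E d → ℝ := fun ζ => lowWeight d s w ‖ζ‖ with hp
  set q : E d → ℝ := fun ζ => ‖ζ‖ ^ s' * w' ‖ζ‖ with hq
  have hpm : Measurable p := measurable_lowWeight hw s
  have hqm : Measurable q := measurable_rpow_mul_weight hw' s'
  have hωy := hω.pos hy.le
  have hwy := hw'.pos hy.le
  set X : ℝ := y ^ (s - (d : ℝ) / 2) * (ω y / w' y) with hX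
  have hX0 : 0 ≤ X := by positivity
  have e1 : y ^ (s + s' - (d : ℝ) / 2) * ω y = X * (y ^ s' * w' y) := by
    rw [hX, show s + s' - (d : ℝ) / 2 = (s - (d : ℝ) / 2) + s' by ring, Real.rpow_add hy]
    field_simp
  -- the weight of `g` at `ξ - ζ` is comparable with its value at `y`
  have hT : ENNReal.ofReal (y ^ s' * w' y) *
      ∫⁻ ζ in Metric.ball 0 (‖ξ‖ / 2), F ζ * G (ξ - ζ) ≤
      ENNReal.ofReal L * ∫⁻ ζ in Metric.ball 0 (‖ξ‖ / 2), ENNReal.ofReal (p ζ)⁻¹ *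
        ((ENNReal.ofReal (p ζ) * F ζ) * (ENNReal.ofReal (q (ξ - ζ)) * G (ξ - ζ))) := by
    rw [← lintegral_const_mul' _ _ ENNReal.ofReal_ne_top,
      ← lintegral_const_mul' _ _ ENNReal.ofReal_ne_top]
    refine lintegral_mono_ae ?_
    filter_upwards [ae_restrict_mem measurableSet_ball, ae_restrict_of_ae (ae_ne_zero hd)]
      with ζ hζ hζ0
    have hζ' : ‖ζ‖ < ‖ξ‖ / 2 := mem_ball_zero_iff.1 hζ
    have hp0 : 0 < p ζ := lowWeight_pos hw (norm_pos_iff.2 hζ0)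
    have n1 : ‖ξ‖ - ‖ζ‖ ≤ ‖ξ - ζ‖ := norm_sub_norm_le ξ ζ
    have n2 : ‖ξ - ζ‖ ≤ ‖ξ‖ + ‖ζ‖ := norm_sub_le ξ ζ
    have hc : y ^ s' * w' y ≤ L * q (ξ - ζ) :=
      hcomp y ‖ξ - ζ‖ hy (by linarith) (by linarith) (by linarith)
    have hpp : ENNReal.ofReal (p ζ)⁻¹ * ENNReal.ofReal (p ζ) = 1 := by
      rw [← ENNReal.ofReal_mul (by positivity), inv_mul_cancel₀ hp0.ne', ENNReal.ofReal_one]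
    calc ENNReal.ofReal (y ^ s' * w' y) * (F ζ * G (ξ - ζ))
        ≤ (ENNReal.ofReal L * ENNReal.ofReal (q (ξ - ζ))) * (F ζ * G (ξ - ζ)) := by
          rw [← ENNReal.ofReal_mul hL.le]
          gcongr
      _ = (ENNReal.ofReal (p ζ)⁻¹ * ENNReal.ofReal (p ζ)) *
          ((ENNReal.ofReal L * ENNReal.ofReal (q (ξ - ζ))) * (F ζ * G (ξ - ζ))) := by
          rw [hpp, one_mul]
      _ = _ := by ring
  have hJ : ∫⁻ ζ in Metric.ball (0 : E d) (‖ξ‖ / 2), ENNReal.ofReal (p ζ)⁻¹ ^ 2 ≤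
      ENNReal.ofReal (sphereArea d * (y ^ ((d : ℝ) - 2 * s) * lowIntegral d s w y)) := by
    rw [← lintegral_lowWeight hd hs hw hy]
    calc ∫⁻ ζ in Metric.ball (0 : E d) (‖ξ‖ / 2), ENNReal.ofReal (p ζ)⁻¹ ^ 2
        ≤ ∫⁻ ζ in Metric.ball (0 : E d) y, ENNReal.ofReal (p ζ)⁻¹ ^ 2 :=
          lintegral_mono_set (Metric.ball_subset_ball (by linarith))
      _ = _ := by
          refine lintegral_congr_ae (ae_restrict_of_ae ?_)
          filter_upwards [ae_ne_zero hd] with ζ hζ0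
          have hp0 : 0 < p ζ := lowWeight_pos hw (norm_pos_iff.2 hζ0)
          rw [← ENNReal.ofReal_pow (by positivity), inv_pow]
  have hCS := sq_lintegral_mul_le (volume.restrict (Metric.ball (0 : E d) (‖ξ‖ / 2)))
    (f := fun ζ => ENNReal.ofReal (p ζ)⁻¹)
    (g := fun ζ => (ENNReal.ofReal (p ζ) * F ζ) * (ENNReal.ofReal (q (ξ - ζ)) * G (ξ - ζ)))
    hpm.inv.ennreal_ofReal.aemeasurable
    ((hpm.ennreal_ofReal.mul hF).mul ((hqm.ennreal_ofReal.mul hG).comp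
      (measurable_id.const_sub ξ))).aemeasurable
  have hA : ∫⁻ ζ in Metric.ball (0 : E d) (‖ξ‖ / 2), ((ENNReal.ofReal (p ζ) * F ζ) *
      (ENNReal.ofReal (q (ξ - ζ)) * G (ξ - ζ))) ^ 2 ≤
      ∫⁻ ζ, weightedSq (lowWeight d s w) F ζ * weightedSq (fun r => r ^ s' * w' r) G (ξ - ζ) := by
    refine (setLIntegral_le_lintegral _ _).trans (le_of_eq (lintegral_congr fun ζ => ?_))
    rw [mul_pow]
    rfl
  have hI := lowIntegral_nonneg (d := d) (s := s) (w := w) hy.le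
  have hreal : X ^ 2 * (sphereArea d * (y ^ ((d : ℝ) - 2 * s) * lowIntegral d s w y)) ≤
      sphereArea d * C ^ 2 * Γ y ^ 2 := by
    have h3 : 0 ≤ ω y / w' y * (lowIntegral d s w y) ^ ((1 : ℝ) / 2) := by positivity
    have h4 := pow_le_pow_left₀ h3 (hcond y hy.le) 2
    have e2 : ((lowIntegral d s w y) ^ ((1 : ℝ) / 2)) ^ 2 = lowIntegral d s w y := by
      rw [← Real.rpow_natCast, ← Real.rpow_mul hI]
      norm_num
    have e3 : (y ^ (s - (d : ℝ) / 2)) ^ 2 * y ^ ((d : ℝ) - 2 * s) = 1 := by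
      rw [← Real.rpow_natCast, ← Real.rpow_mul hy.le, ← Real.rpow_add hy]
      convert Real.rpow_zero y using 2
      push_cast
      ring
    rw [mul_pow, mul_pow, e2] at h4
    calc X ^ 2 * (sphereArea d * (y ^ ((d : ℝ) - 2 * s) * lowIntegral d s w y))
        = sphereArea d * (((y ^ (s - (d : ℝ) / 2)) ^ 2 * y ^ ((d : ℝ) - 2 * s)) *
          ((ω y / w' y) ^ 2 * lowIntegral d s w y)) := by rw [hX]; ring
      _ ≤ sphereArea d * (C ^ 2 * Γ y ^ 2) := by
          rw [e3, one_mul]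
          exact mul_le_mul_of_nonneg_left h4 (sphereArea_nonneg d)
      _ = _ := by ring
  set A : ℝ≥0∞ :=
    ∫⁻ ζ, weightedSq (lowWeight d s w) F ζ * weightedSq (fun r => r ^ s' * w' r) G (ξ - ζ)
  set J : ℝ := sphereArea d * (y ^ ((d : ℝ) - 2 * s) * lowIntegral d s w y)
  set T : ℝ≥0∞ := ∫⁻ ζ in Metric.ball 0 (‖ξ‖ / 2), F ζ * G (ξ - ζ)
  calc (ENNReal.ofReal (y ^ (s + s' - (d : ℝ) / 2) * ω y) * T) ^ 2
      = (ENNReal.ofReal X * ENNReal.ofReal (y ^ s' * w' y) * T) ^ 2 := by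
        rw [e1, ENNReal.ofReal_mul hX0]
    _ ≤ ENNReal.ofReal X ^ 2 * ENNReal.ofReal L ^ 2 * (ENNReal.ofReal J * A) :=
        sq_mul_le_of_mul_le hT (hCS.trans (mul_le_mul' hJ hA))
    _ = ENNReal.ofReal (L ^ 2 * (X ^ 2 * J)) * A := by
        rw [ENNReal.ofReal_mul (sq_nonneg L), ENNReal.ofReal_mul (sq_nonneg X),
          ENNReal.ofReal_pow hL.le, ENNReal.ofReal_pow hX0]
        ring
    _ ≤ ENNReal.ofReal (L ^ 2 * (sphereArea d * C ^ 2 * Γ y ^ 2)) * A := by gcongr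
    _ = _ := by
        have := sphereArea_nonneg d
        rw [← ENNReal.ofReal_pow (hΓ y hy.le), ← mul_assoc (ENNReal.ofReal _) _ A,
          ← ENNReal.ofReal_mul (by positivity)]
        congr 2
        ring

/-- The homogeneous kernel `|ξ|^{2ε-d} |ζ|^{-2ε}` on `|ξ| < 3 |ζ|`, integrable in `ξ`. -/
def highHighKernel {d : ℕ} (ε : ℝ) (ξ ζ : E d) : ℝ≥0∞ :=
  if ‖ξ‖ < 3 * ‖ζ‖ then
    ENNReal.ofReal (‖ξ‖ ^ (2 * ε - d)) * ENNReal.ofReal (‖ζ‖ ^ (-(2 * ε))) else 0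

/-- The density, in `ξ`, of the interaction of comparable frequencies. -/
def highHighDensity {d : ℕ} (ε : ℝ) (U : E d → ℝ≥0∞) (ξ : E d) : ℝ≥0∞ :=
  ∫⁻ ζ, highHighKernel ε ξ ζ * U ζ

theorem measurable_highHighKernel {d : ℕ} (ε : ℝ) :
    Measurable fun x : E d × E d => highHighKernel ε x.1 x.2 := by
  refine Measurable.ite (measurableSet_lt (by fun_prop) (by fun_prop)) ?_ measurable_const
  fun_prop

theorem measurable_highHighKernel_left {d : ℕ} (ε : ℝ) (ζ : E d) :
    Measurable fun ξ : E d => highHighKernel ε ξ ζ := by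
  unfold highHighKernel
  refine Measurable.ite (measurableSet_lt (by fun_prop) (by fun_prop)) ?_ measurable_const
  fun_prop

theorem measurable_highHighKernel_mul {d : ℕ} (ε : ℝ) {U : E d → ℝ≥0∞} (hU : Measurable U) :
    Measurable fun x : E d × E d => highHighKernel ε x.1 x.2 * U x.2 :=
  (measurable_highHighKernel ε).mul (hU.comp measurable_snd)

theorem measurable_highHighDensity {d : ℕ} (ε : ℝ) {U : E d → ℝ≥0∞} (hU : Measurable U) :
    Measurable (highHighDensity ε U) := by
  unfold highHighDensity
  exact (measurable_highHighKernel_mul ε hU).lintegral_prod_right'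

/-- Fubini's theorem reduces this to the integral of `|ξ| ^ (2ε - d)` over `|ξ| < 3 |ζ|`, which is a
multiple of `|ζ| ^ (2ε)`. -/
theorem lintegral_highHighDensity_le {d : ℕ} (hd : 1 ≤ d) {ε : ℝ} (hε : 0 < ε) {U : E d → ℝ≥0∞}
    (hU : Measurable U) :
    ∫⁻ ξ, highHighDensity ε U ξ ≤
      ENNReal.ofReal (sphereArea d * (3 ^ (2 * ε) / (2 * ε))) * ∫⁻ ζ, U ζ := by
  unfold highHighDensity
  rw [lintegral_lintegral_swap (measurable_highHighKernel_mul ε hU).aemeasurable,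
    ← lintegral_const_mul _ hU]
  refine lintegral_mono_ae ?_
  filter_upwards [ae_ne_zero hd] with ζ hζ
  have hζ' : 0 < ‖ζ‖ := norm_pos_iff.2 hζ
  have hk := measurable_highHighKernel_left ε ζ
  rw [lintegral_mul_const _ hk]
  gcongr
  have e : (fun ξ : E d => highHighKernel ε ξ ζ) =
      (Metric.ball (0 : E d) (3 * ‖ζ‖)).indicator fun ξ =>
        ENNReal.ofReal (‖ξ‖ ^ (2 * ε - d)) * ENNReal.ofReal (‖ζ‖ ^ (-(2 * ε))) := by
    ext ξ
    simp [indicator, highHighKernel]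
  rw [e, lintegral_indicator measurableSet_ball, lintegral_mul_const _ (by fun_prop),
    lintegral_ball_norm_rpow hd (by positivity) (by positivity), ← ENNReal.ofReal_mul
      (mul_nonneg (sphereArea_nonneg d) (by positivity))]
  refine ENNReal.ofReal_le_ofReal (le_of_eq ?_)
  rw [Real.mul_rpow (by norm_num) hζ'.le, Real.rpow_neg hζ'.le]
  field_simp

/-- The weights of comparable frequencies of size `a`, `b` dominate those at a lower frequency `y`,
with a gain of a positive power because `s + s' > 0`. -/
theorem weight_mul_weight_le {s s' : ℝ} (hss' : 0 < s + s') {w w' : ℝ → ℝ} (hw : IsWeight w)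
    (hw' : IsWeight w') :
    ∃ K : ℝ, 0 < K ∧ ∀ x y a b, 0 < x → x ≤ 2 * y → y ≤ 2 * x → x ≤ 2 * a → a ≤ 3 * b → b ≤ 3 * a →
      y ^ s * w y * (y ^ s' * w' y) ≤
        K * ((x / a) ^ ((s + s') / 2) * (a ^ s * w a * (b ^ s' * w' b))) := by
  obtain ⟨K₁, hK₁, h₁⟩ := hw.le_mul_of_comparable (show 0 < (s + s') / 4 by linarith)
  obtain ⟨K₂, hK₂, h₂⟩ := hw'.le_mul_of_comparable (show 0 < (s + s') / 4 by linarith)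
  obtain ⟨K₃, hK₃, h₃⟩ := hw'.rpow_mul_le_of_comparable s' (t := 3) (by norm_num)
  refine ⟨2 ^ (s + s') * 16 ^ ((s + s') / 2) * K₁ * K₂ * K₃, by positivity,
    fun x y a b hx hxy hyx hxa hab hba => ?_⟩
  have hy : 0 < y := by linarith
  have ha : 0 < a := by linarith
  have hb : 0 < b := by linarith
  -- `y` and `a` differ at most by the factor `16 a / x`; each weight costs its power
  -- `(s + s') / 4`, together half of the available gain `s + s'`
  have t1 : y ≤ 16 * (a / x) * a := by
    have : 1 ≤ a / x * 2 := by rw [div_mul_eq_mul_div, one_le_div hx]; linarith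
    nlinarith
  have t2 : a ≤ 16 * (a / x) * y := by
    have : 16 * (a / x) * y = a * (16 * (y / x)) := by ring
    rw [this]
    refine le_mul_of_one_le_right ha.le ?_
    have : 1 / 2 ≤ y / x := by rw [le_div_iff₀ hx]; linarith
    linarith
  have r₁ := h₁ y a _ hy ha t1 t2
  have r₂ := h₂ y a _ hy ha t1 t2
  have r₃ := h₃ a b ha hb hab hba
  have hwa := hw.pos ha.le
  have hwa' := hw'.pos ha.le
  have hwy := hw.pos hy.le
  have hwy' := hw'.pos hy.le
  have hwb' := hw'.pos hb.le
  have p1 : y ^ (s + s') ≤ 2 ^ (s + s') * x ^ (s + s') := by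
    rw [← Real.mul_rpow (by norm_num) hx.le]
    exact Real.rpow_le_rpow hy.le hyx hss'.le
  have p2 : (16 * (a / x)) ^ ((s + s') / 4) * (16 * (a / x)) ^ ((s + s') / 4) =
      16 ^ ((s + s') / 2) * (a / x) ^ ((s + s') / 2) := by
    rw [← Real.rpow_add (by positivity), Real.mul_rpow (by norm_num) (by positivity)]
    ring_nf
  have p3 : (a / x) ^ ((s + s') / 2) * x ^ (s + s') =
      (x / a) ^ ((s + s') / 2) * (a ^ s * a ^ s') := by
    rw [← Real.rpow_add ha, Real.div_rpow ha.le hx.le, Real.div_rpow hx.le ha.le]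
    have q1 : a ^ (s + s') = a ^ ((s + s') / 2) * a ^ ((s + s') / 2) := by
      rw [← Real.rpow_add ha]; ring_nf
    have q2 : x ^ (s + s') = x ^ ((s + s') / 2) * x ^ ((s + s') / 2) := by
      rw [← Real.rpow_add hx]; ring_nf
    rw [q1, q2]
    field_simp
  calc y ^ s * w y * (y ^ s' * w' y) = y ^ (s + s') * (w y * w' y) := by
        rw [Real.rpow_add hy]; ring
    _ ≤ (2 ^ (s + s') * x ^ (s + s')) * ((K₁ * (16 * (a / x)) ^ ((s + s') / 4) * w a) *
          (K₂ * (16 * (a / x)) ^ ((s + s') / 4) * w' a)) := by gcongr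
    _ = 2 ^ (s + s') * K₁ * K₂ * w a * w' a * x ^ (s + s') *
          ((16 * (a / x)) ^ ((s + s') / 4) * (16 * (a / x)) ^ ((s + s') / 4)) := by ring
    _ = 2 ^ (s + s') * 16 ^ ((s + s') / 2) * K₁ * K₂ * w a * w' a *
          ((a / x) ^ ((s + s') / 2) * x ^ (s + s')) := by rw [p2]; ring
    _ = 2 ^ (s + s') * 16 ^ ((s + s') / 2) * K₁ * K₂ * ((x / a) ^ ((s + s') / 2) *
          (a ^ s * w a * (a ^ s' * w' a))) := by rw [p3]; ring
    _ ≤ 2 ^ (s + s') * 16 ^ ((s + s') / 2) * K₁ * K₂ * ((x / a) ^ ((s + s') / 2) *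
          (a ^ s * w a * (K₃ * (b ^ s' * w' b)))) := by gcongr
    _ = _ := by ring

/-- The interaction of frequencies that are both at least `|ξ| / 2`. -/
theorem highHigh_bound {d : ℕ} {s s' : ℝ} (hss' : 0 < s + s')
    {ω w w' Γ : ℝ → ℝ} (hω : IsWeight ω) (hw : IsWeight w) (hw' : IsWeight w')
    (hΓ : ∀ y, 0 ≤ y → 0 ≤ Γ y) {C : ℝ}
    (hcond : ∀ y, 0 ≤ y → ω y / (w y * w' y) ≤ C * Γ y) :
    ∃ K : ℝ, 0 ≤ K ∧ ∀ F G : E d → ℝ≥0∞, Measurable F → Measurable G →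
      ∀ ξ : E d, ξ ≠ 0 → ∀ y : ℝ, 0 < y → ‖ξ‖ ≤ 2 * y → y ≤ 2 * ‖ξ‖ →
        (ENNReal.ofReal (y ^ (s + s' - (d : ℝ) / 2) * ω y) *
            ∫⁻ ζ in {ζ | ‖ξ‖ ≤ 2 * ‖ζ‖ ∧ ‖ξ‖ ≤ 2 * ‖ξ - ζ‖}, F ζ * G (ξ - ζ)) ^ 2 ≤
          ENNReal.ofReal K * (ENNReal.ofReal (Γ y) ^ 2 *
            (highHighDensity ((s + s') / 2) (weightedSq (fun r => r ^ s * w r) F) ξ *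
              ∫⁻ η, weightedSq (fun r => r ^ s' * w' r) G η)) := by
  obtain ⟨L, hL, hcomp⟩ := weight_mul_weight_le hss' hw hw'
  refine ⟨L ^ 2 * C ^ 2 * 2 ^ (d : ℝ), by positivity, fun F G hF hG ξ hξ y hy h1 h2 => ?_⟩
  have hx : 0 < ‖ξ‖ := norm_pos_iff.2 hξ
  set S : Set (E d) := {ζ | ‖ξ‖ ≤ 2 * ‖ζ‖ ∧ ‖ξ‖ ≤ 2 * ‖ξ - ζ‖} with hS
  have hSm : MeasurableSet S := by
    have m1 : MeasurableSet {ζ : E d | ‖ξ‖ ≤ 2 * ‖ζ‖} :=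
      measurableSet_le measurable_const (by fun_prop)
    have m2 : MeasurableSet {ζ : E d | ‖ξ‖ ≤ 2 * ‖ξ - ζ‖} :=
      measurableSet_le measurable_const (by fun_prop)
    exact m1.inter m2
  set p : E d → ℝ := fun ζ => ‖ζ‖ ^ s * w ‖ζ‖ with hp
  set q : E d → ℝ := fun ζ => ‖ζ‖ ^ s' * w' ‖ζ‖ with hq
  set k : E d → ℝ := fun ζ => (‖ξ‖ / ‖ζ‖) ^ ((s + s') / 2) with hk
  have hpm : Measurable p := measurable_rpow_mul_weight hw s
  have hqm : Measurable q := measurable_rpow_mul_weight hw' s'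
  have hkm : Measurable k := by fun_prop
  have hωy := hω.pos hy.le
  have hwy := hw.pos hy.le
  have hwy' := hw'.pos hy.le
  set X : ℝ := y ^ (-(d : ℝ) / 2) * (ω y / (w y * w' y)) with hX
  have hX0 : 0 ≤ X := by positivity
  have e1 : y ^ (s + s' - (d : ℝ) / 2) * ω y = X * (y ^ s * w y * (y ^ s' * w' y)) := by
    rw [hX, show s + s' - (d : ℝ) / 2 = -(d : ℝ) / 2 + s + s' by ring, Real.rpow_add hy,
      Real.rpow_add hy]
    field_simp
  have hT : ENNReal.ofReal (y ^ s * w y * (y ^ s' * w' y)) * ∫⁻ ζ in S, F ζ * G (ξ - ζ) ≤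
      ENNReal.ofReal L * ∫⁻ ζ in S, (ENNReal.ofReal (k ζ) * (ENNReal.ofReal (p ζ) * F ζ)) *
        (ENNReal.ofReal (q (ξ - ζ)) * G (ξ - ζ)) := by
    rw [← lintegral_const_mul' _ _ ENNReal.ofReal_ne_top,
      ← lintegral_const_mul' _ _ ENNReal.ofReal_ne_top]
    refine setLIntegral_mono' hSm fun ζ hζ => ?_
    have n1 : ‖ξ - ζ‖ ≤ ‖ξ‖ + ‖ζ‖ := norm_sub_le ξ ζ
    have n2 : ‖ζ‖ ≤ ‖ξ‖ + ‖ξ - ζ‖ := by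
      have := norm_sub_le ξ (ξ - ζ)
      rwa [sub_sub_cancel] at this
    have ha : 0 < ‖ζ‖ := by linarith [hζ.1]
    have hwa := hw.pos ha.le
    have hc := hcomp ‖ξ‖ y ‖ζ‖ ‖ξ - ζ‖ hx h1 h2 hζ.1 (by linarith [hζ.2]) (by linarith [hζ.1])
    calc ENNReal.ofReal (y ^ s * w y * (y ^ s' * w' y)) * (F ζ * G (ξ - ζ))
        ≤ ENNReal.ofReal (L * (k ζ * (p ζ * q (ξ - ζ)))) * (F ζ * G (ξ - ζ)) := by gcongr
      _ = _ := by
          rw [ENNReal.ofReal_mul hL.le, ENNReal.ofReal_mul (by positivity),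
            ENNReal.ofReal_mul (by positivity)]
          ring
  have hCS := sq_lintegral_mul_le (volume.restrict S)
    (f := fun ζ => ENNReal.ofReal (k ζ) * (ENNReal.ofReal (p ζ) * F ζ))
    (g := fun ζ => ENNReal.ofReal (q (ξ - ζ)) * G (ξ - ζ))
    (hkm.ennreal_ofReal.mul (hpm.ennreal_ofReal.mul hF)).aemeasurable
    ((hqm.ennreal_ofReal.mul hG).comp (measurable_id.const_sub ξ)).aemeasurable
  have hB : ∫⁻ ζ in S, (ENNReal.ofReal (q (ξ - ζ)) * G (ξ - ζ)) ^ 2 ≤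
      ∫⁻ η, weightedSq (fun r => r ^ s' * w' r) G η :=
    (setLIntegral_le_lintegral _ _).trans (le_of_eq
      (lintegral_sub_left_eq_self (weightedSq (fun r => r ^ s' * w' r) G) ξ))
  have hA : ENNReal.ofReal (‖ξ‖ ^ (-(d : ℝ))) *
      ∫⁻ ζ in S, (ENNReal.ofReal (k ζ) * (ENNReal.ofReal (p ζ) * F ζ)) ^ 2 ≤
      highHighDensity ((s + s') / 2) (weightedSq (fun r => r ^ s * w r) F) ξ := by
    rw [← lintegral_const_mul' _ _ ENNReal.ofReal_ne_top]
    refine le_trans (setLIntegral_mono' hSm fun ζ hζ => ?_) (setLIntegral_le_lintegral S _)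
    have ha : 0 < ‖ζ‖ := by linarith [hζ.1]
    rw [highHighKernel, if_pos (by linarith [hζ.1]), mul_pow, ← mul_assoc,
      ← ENNReal.ofReal_pow (by positivity), ← ENNReal.ofReal_mul (by positivity),
      ← ENNReal.ofReal_mul (by positivity)]
    refine le_of_eq (congrArg₂ _ (congrArg _ ?_) rfl)
    simp only [hk]
    rw [← Real.rpow_natCast, ← Real.rpow_mul (by positivity), Real.div_rpow hx.le ha.le,
      Real.rpow_neg ha.le, sub_eq_add_neg, Real.rpow_add hx]
    push_cast
    rw [show (s + s') / 2 * 2 = 2 * ((s + s') / 2) by ring]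
    field_simp
  have hreal : X ^ 2 ≤ 2 ^ (d : ℝ) * C ^ 2 * Γ y ^ 2 * ‖ξ‖ ^ (-(d : ℝ)) := by
    have h3 : 0 ≤ ω y / (w y * w' y) := by positivity
    have h4 := pow_le_pow_left₀ h3 (hcond y hy.le) 2
    have e2 : (y ^ (-(d : ℝ) / 2)) ^ 2 = y ^ (-(d : ℝ)) := by
      rw [← Real.rpow_natCast, ← Real.rpow_mul hy.le]
      congr 1
      push_cast
      ring
    have e3 := rpow_le_of_comparable (s := -(d : ℝ)) (t := 2) hy hx (by norm_num) h2 h1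
    rw [abs_neg, abs_of_nonneg (by positivity)] at e3
    calc X ^ 2 = y ^ (-(d : ℝ)) * (ω y / (w y * w' y)) ^ 2 := by rw [hX, mul_pow, e2]
      _ ≤ (2 ^ (d : ℝ) * ‖ξ‖ ^ (-(d : ℝ))) * (C * Γ y) ^ 2 := by gcongr
      _ = _ := by ring
  set A : ℝ≥0∞ := highHighDensity ((s + s') / 2) (weightedSq (fun r => r ^ s * w r) F) ξ
  set B : ℝ≥0∞ := ∫⁻ η, weightedSq (fun r => r ^ s' * w' r) G η
  set T : ℝ≥0∞ := ∫⁻ ζ in S, F ζ * G (ξ - ζ)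
  set U : ℝ≥0∞ := ∫⁻ ζ in S, (ENNReal.ofReal (k ζ) * (ENNReal.ofReal (p ζ) * F ζ)) ^ 2
  calc (ENNReal.ofReal (y ^ (s + s' - (d : ℝ) / 2) * ω y) * T) ^ 2
      = (ENNReal.ofReal X * ENNReal.ofReal (y ^ s * w y * (y ^ s' * w' y)) * T) ^ 2 := by
        rw [e1, ENNReal.ofReal_mul hX0]
    _ ≤ ENNReal.ofReal X ^ 2 * ENNReal.ofReal L ^ 2 * (U * B) :=
        sq_mul_le_of_mul_le hT (hCS.trans (mul_le_mul' le_rfl hB))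
    _ = ENNReal.ofReal (L ^ 2) * ENNReal.ofReal (X ^ 2) * (U * B) := by
        rw [ENNReal.ofReal_pow hL.le, ENNReal.ofReal_pow hX0]
        ring
    _ ≤ ENNReal.ofReal (L ^ 2) *
          ENNReal.ofReal (2 ^ (d : ℝ) * C ^ 2 * Γ y ^ 2 * ‖ξ‖ ^ (-(d : ℝ))) * (U * B) := by gcongr
    _ = ENNReal.ofReal (L ^ 2 * C ^ 2 * 2 ^ (d : ℝ)) * (ENNReal.ofReal (Γ y) ^ 2 *
          ((ENNReal.ofReal (‖ξ‖ ^ (-(d : ℝ))) * U) * B)) := by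
        rw [← ENNReal.ofReal_pow (hΓ y hy.le), ENNReal.ofReal_mul (by positivity),
          show 2 ^ (d : ℝ) * C ^ 2 * Γ y ^ 2 = (C ^ 2 * 2 ^ (d : ℝ)) * Γ y ^ 2 by ring,
          ENNReal.ofReal_mul (by positivity), mul_assoc (L ^ 2),
          ENNReal.ofReal_mul (p := L ^ 2) (by positivity)]
        ring
    _ ≤ _ := by gcongr

/-- The pointwise form of the product estimate: up to weights taken at `y`, comparable with `|ξ|`,
the square of the convolution of `F` and `G` is bounded by three integrable functions of `ξ`. -/
theorem exists_convolution_bound {d : ℕ} (hd : 1 ≤ d) {s s' : ℝ} (hs : s ≤ (d : ℝ) / 2)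
    (hs' : s' ≤ (d : ℝ) / 2) (hss' : 0 < s + s') {ω ω₁ ω₂ ω₃ ω₁' ω₂' ω₃' : ℝ → ℝ}
    (hω : IsWeight ω) (hω₁ : IsWeight ω₁) (hω₂ : IsWeight ω₂) (hω₃ : IsWeight ω₃)
    (hω₁' : IsWeight ω₁') (hω₂' : IsWeight ω₂') (hω₃' : IsWeight ω₃')
    {Γ₁ Γ₂ Γ₃ : ℝ → ℝ} (hΓ₁ : ∀ y, 0 ≤ y → 0 ≤ Γ₁ y) (hΓ₂ : ∀ y, 0 ≤ y → 0 ≤ Γ₂ y)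
    (hΓ₃ : ∀ y, 0 ≤ y → 0 ≤ Γ₃ y) {C₁ C₂ C₃ : ℝ}
    (hcond₁ : ∀ y, 0 ≤ y →
      ω y / ω₁' y * (lowIntegral d s ω₁ y) ^ ((1 : ℝ) / 2) ≤ C₁ * Γ₁ y)
    (hcond₂ : ∀ y, 0 ≤ y →
      ω y / ω₂' y * (lowIntegral d s' ω₂ y) ^ ((1 : ℝ) / 2) ≤ C₂ * Γ₂ y)
    (hcond₃ : ∀ y, 0 ≤ y → ω y / (ω₃ y * ω₃' y) ≤ C₃ * Γ₃ y) :
    ∃ K : ℝ, 0 ≤ K ∧ ∀ F G : E d → ℝ≥0∞, Measurable F → Measurable G →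
      ∃ A₁ A₂ A₃ : E d → ℝ≥0∞, Measurable A₁ ∧ Measurable A₂ ∧ Measurable A₃ ∧
        (∫⁻ ξ, A₁ ξ ≤ ENNReal.ofReal K * ((∫⁻ ζ, weightedSq (lowWeight d s ω₁) F ζ) *
          ∫⁻ η, weightedSq (fun r => r ^ s' * ω₁' r) G η)) ∧
        (∫⁻ ξ, A₂ ξ ≤ ENNReal.ofReal K * ((∫⁻ ζ, weightedSq (lowWeight d s' ω₂) G ζ) *
          ∫⁻ η, weightedSq (fun r => r ^ s * ω₂' r) F η)) ∧
        (∫⁻ ξ, A₃ ξ ≤ ENNReal.ofReal K * ((∫⁻ ζ, weightedSq (fun r => r ^ s * ω₃ r) F ζ) *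
          ∫⁻ η, weightedSq (fun r => r ^ s' * ω₃' r) G η)) ∧
        ∀ ξ : E d, ξ ≠ 0 → ∀ y : ℝ, 0 < y → ‖ξ‖ ≤ 2 * y → y ≤ 2 * ‖ξ‖ →
          (ENNReal.ofReal (y ^ (s + s' - (d : ℝ) / 2) * ω y) * ∫⁻ ζ, F ζ * G (ξ - ζ)) ^ 2 ≤
            ENNReal.ofReal K * (ENNReal.ofReal (Γ₁ y) ^ 2 * A₁ ξ +
              ENNReal.ofReal (Γ₂ y) ^ 2 * A₂ ξ + ENNReal.ofReal (Γ₃ y) ^ 2 * A₃ ξ) := by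
  obtain ⟨K₁, hK₁, h₁⟩ := lowHigh_bound hd (s' := s') hs hω hω₁ hω₁' hΓ₁ hcond₁
  obtain ⟨K₂, hK₂, h₂⟩ := lowHigh_bound hd (s' := s) hs' hω hω₂ hω₂' hΓ₂ hcond₂
  obtain ⟨K₃, hK₃, h₃⟩ := highHigh_bound (d := d) hss' hω hω₃ hω₃' hΓ₃ hcond₃
  set K₄ : ℝ := sphereArea d * (3 ^ (2 * ((s + s') / 2)) / (2 * ((s + s') / 2))) with hK₄
  have hK₄0 : 0 ≤ K₄ := mul_nonneg (sphereArea_nonneg d) (by positivity)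
  set K : ℝ := 9 * (K₁ + K₂ + K₃) + K₄ + 1 with hK
  have hone : 1 ≤ ENNReal.ofReal K := ENNReal.one_le_ofReal.2 (by rw [hK]; linarith)
  have h9 : ∀ k, 0 ≤ k → k ≤ K₁ + K₂ + K₃ → ∀ Z : ℝ≥0∞,
      9 * (ENNReal.ofReal k * Z) ≤ ENNReal.ofReal K * Z := by
    intro k hk hkK Z
    rw [← mul_assoc]
    gcongr
    rw [← ENNReal.ofReal_ofNat, ← ENNReal.ofReal_mul (by norm_num)]
    exact ENNReal.ofReal_le_ofReal (by rw [hK]; linarith)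
  refine ⟨K, by positivity, fun F G hF hG => ?_⟩
  have mF₁ := measurable_weightedSq (measurable_lowWeight (d := d) hω₁ s) hF
  have mG₁ := measurable_weightedSq (p := fun r => r ^ s' * ω₁' r)
    (measurable_rpow_mul_weight (d := d) hω₁' s') hG
  have mG₂ := measurable_weightedSq (measurable_lowWeight (d := d) hω₂ s') hG
  have mF₂ := measurable_weightedSq (p := fun r => r ^ s * ω₂' r)
    (measurable_rpow_mul_weight (d := d) hω₂' s) hF
  have mF₃ := measurable_weightedSq (p := fun r => r ^ s * ω₃ r)
    (measurable_rpow_mul_weight (d := d) hω₃ s) hF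
  have mconv : ∀ a b : E d → ℝ≥0∞, Measurable a → Measurable b →
      Measurable fun ξ => ∫⁻ ζ, a ζ * b (ξ - ζ) := by
    intro a b ha hb
    refine Measurable.lintegral_prod_right' (f := fun x : E d × E d => a x.2 * b (x.1 - x.2)) ?_
    exact (ha.comp measurable_snd).mul (hb.comp (measurable_fst.sub measurable_snd))
  refine ⟨fun ξ => ∫⁻ ζ, weightedSq (lowWeight d s ω₁) F ζ *
      weightedSq (fun r => r ^ s' * ω₁' r) G (ξ - ζ),
    fun ξ => ∫⁻ ζ, weightedSq (lowWeight d s' ω₂) G ζ *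
      weightedSq (fun r => r ^ s * ω₂' r) F (ξ - ζ),
    fun ξ => highHighDensity ((s + s') / 2) (weightedSq (fun r => r ^ s * ω₃ r) F) ξ *
      ∫⁻ η, weightedSq (fun r => r ^ s' * ω₃' r) G η,
    mconv _ _ mF₁ mG₁, mconv _ _ mG₂ mF₂, (measurable_highHighDensity _ mF₃).mul_const _,
    ?_, ?_, ?_, fun ξ hξ y hy hy1 hy2 => ?_⟩
  · rw [lintegral_lintegral_mul_sub mF₁ mG₁]
    exact le_mul_of_one_le_left zero_le hone
  · rw [lintegral_lintegral_mul_sub mG₂ mF₂]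
    exact le_mul_of_one_le_left zero_le hone
  · rw [lintegral_mul_const _ (measurable_highHighDensity _ mF₃), ← mul_assoc]
    gcongr
    refine (lintegral_highHighDensity_le hd (by linarith) mF₃).trans ?_
    gcongr
    rw [hK]
    linarith
  · -- every `ζ` satisfies `|ζ| < |ξ|/2`, or `|ξ - ζ| < |ξ|/2`, or neither
    have hcover : ∫⁻ ζ, F ζ * G (ξ - ζ) ≤
        (∫⁻ ζ in Metric.ball 0 (‖ξ‖ / 2), F ζ * G (ξ - ζ)) +
        (∫⁻ ζ in Metric.ball 0 (‖ξ‖ / 2), G ζ * F (ξ - ζ)) +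
        ∫⁻ ζ in {ζ | ‖ξ‖ ≤ 2 * ‖ζ‖ ∧ ‖ξ‖ ≤ 2 * ‖ξ - ζ‖}, F ζ * G (ξ - ζ) := by
      have e : ∫⁻ ζ in Metric.ball 0 (‖ξ‖ / 2), G ζ * F (ξ - ζ) =
          ∫⁻ ζ in {ζ | ‖ξ - ζ‖ < ‖ξ‖ / 2}, F ζ * G (ξ - ζ) := by
        have m : MeasurableSet {ζ : E d | ‖ξ - ζ‖ < ‖ξ‖ / 2} :=
          measurableSet_lt (by fun_prop) measurable_const
        rw [← lintegral_indicator m, ← lintegral_indicator measurableSet_ball,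
          ← lintegral_sub_left_eq_self _ ξ]
        refine lintegral_congr fun ζ => ?_
        by_cases h : ‖ξ - ζ‖ < ‖ξ‖ / 2 <;> simp [indicator, h, mul_comm]
      rw [e, ← setLIntegral_univ]
      have hsub : (univ : Set (E d)) ⊆ (Metric.ball 0 (‖ξ‖ / 2) ∪ {ζ | ‖ξ - ζ‖ < ‖ξ‖ / 2}) ∪
          {ζ | ‖ξ‖ ≤ 2 * ‖ζ‖ ∧ ‖ξ‖ ≤ 2 * ‖ξ - ζ‖} := by
        intro ζ _
        by_cases a : ‖ζ‖ < ‖ξ‖ / 2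
        · exact Or.inl (Or.inl (mem_ball_zero_iff.2 a))
        by_cases b : ‖ξ - ζ‖ < ‖ξ‖ / 2
        · exact Or.inl (Or.inr b)
        · exact Or.inr ⟨by linarith, by linarith⟩
      refine (lintegral_mono_set hsub).trans ((lintegral_union_le _ _ _).trans ?_)
      gcongr
      exact lintegral_union_le _ _ _
    have r₁ := h₁ F G hF hG ξ hξ y hy hy1 hy2
    have r₂ := h₂ G F hG hF ξ hξ y hy hy1 hy2
    have r₃ := h₃ F G hF hG ξ hξ y hy hy1 hy2
    rw [add_comm s' s] at r₂
    refine (pow_le_pow_left' (mul_le_mul' le_rfl hcover) 2).trans ?_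
    rw [mul_add, mul_add]
    refine (add_three_sq_le _ _ _).trans ?_
    rw [mul_add, mul_add, mul_add, mul_add]
    exact add_le_add (add_le_add
      ((mul_le_mul' le_rfl r₁).trans (h9 _ hK₁ (by linarith) _))
      ((mul_le_mul' le_rfl r₂).trans (h9 _ hK₂ (by linarith) _)))
      ((mul_le_mul' le_rfl r₃).trans (h9 _ hK₃ (by linarith) _))

/-! ### The product as the inverse Fourier transform of a convolution -/

/-- The decay factor `(1 + |ξ|²)^{-N}`. -/
def decay {d : ℕ} (N : ℕ) (ξ : E d) : ℝ := ((1 + ‖ξ‖ ^ 2) ^ N)⁻¹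

theorem decay_pos {d : ℕ} (N : ℕ) (ξ : E d) : 0 < decay N ξ := by
  unfold decay
  positivity

theorem continuous_decay {d : ℕ} (N : ℕ) : Continuous (decay N : E d → ℝ) := by
  unfold decay
  exact Continuous.inv₀ (by fun_prop) fun ξ => by positivity

theorem hasTemperateGrowth_one_add_norm_sq_pow {d : ℕ} (N : ℕ) :
    (fun ξ : E d => (((1 + ‖ξ‖ ^ 2) ^ N : ℝ) : ℂ)).HasTemperateGrowth := by
  have h : (fun ξ : E d => 1 + ‖ξ‖ ^ 2).HasTemperateGrowth :=
    (Function.HasTemperateGrowth.const 1).add (Function.hasTemperateGrowth_norm_sq (E d))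
  exact Complex.ofRealCLM.hasTemperateGrowth.comp (h.pow N)

theorem exists_norm_le_decay {d : ℕ} (a : 𝓢(E d, ℂ)) (N : ℕ) :
    ∃ B : ℝ, 0 ≤ B ∧ ∀ z, ‖a z‖ ≤ B * decay N z := by
  set b : 𝓢(E d, ℂ) :=
    SchwartzMap.smulLeftCLM ℂ (fun ξ : E d => (((1 + ‖ξ‖ ^ 2) ^ N : ℝ) : ℂ)) a with hb
  refine ⟨SchwartzMap.seminorm ℝ 0 0 b, apply_nonneg _ _, fun z => ?_⟩
  have h := SchwartzMap.norm_le_seminorm ℝ b z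
  rw [hb, SchwartzMap.smulLeftCLM_apply_apply (hasTemperateGrowth_one_add_norm_sq_pow N),
    norm_smul, Complex.norm_real, Real.norm_of_nonneg (by positivity)] at h
  rw [decay, ← div_eq_mul_inv, le_div_iff₀ (by positivity), mul_comm]
  exact h

/-- The convolution `F ⋆ G`. -/
def conv {d : ℕ} (F G : E d → ℂ) (ξ : E d) : ℂ := ∫ ζ, F ζ * G (ξ - ζ)

/-- The change of variables `(ξ, ζ) ↦ (ζ, ξ - ζ)`. -/
theorem measurePreserving_sub_swap (d : ℕ) :
    MeasurePreserving (fun p : E d × E d => (p.2, p.1 - p.2)) (volume.prod volume)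
      (volume.prod volume) :=
  measurePreserving_prod_sub_swap volume volume

section Conv

variable {d : ℕ} {F G : E d → ℂ} {a : E d → ℂ}

theorem integrable_mul_sub
    (h : Integrable (fun p : E d × E d => a (p.1 + p.2) * (F p.1 * G p.2)) (volume.prod volume)) :
    Integrable (fun p : E d × E d => a p.1 * (F p.2 * G (p.1 - p.2))) (volume.prod volume) := by
  have := (measurePreserving_sub_swap d).integrable_comp_of_integrable h
  refine this.congr (ae_of_all _ fun p => ?_)
  simp

theorem integral_add_eq_integral_conv
    (h : Integrable (fun p : E d × E d => a (p.1 + p.2) * (F p.1 * G p.2)) (volume.prod volume)) :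
    ∫ p : E d × E d, a (p.1 + p.2) * (F p.1 * G p.2) ∂(volume.prod volume) =
      ∫ ξ, a ξ * conv F G ξ := by
  have hT := measurePreserving_sub_swap d
  have h1 : AEStronglyMeasurable (fun p : E d × E d => a (p.1 + p.2) * (F p.1 * G p.2))
      (Measure.map (fun p : E d × E d => (p.2, p.1 - p.2)) (volume.prod volume)) := by
    rw [hT.map_eq]
    exact h.1
  rw [← hT.map_eq, integral_map hT.measurable.aemeasurable h1]
  simp only [add_sub_cancel]
  rw [integral_prod _ (integrable_mul_sub h)]
  refine integral_congr_ae (ae_of_all _ fun ξ => ?_)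
  simp only [conv]
  rw [integral_const_mul]

theorem integrable_mul_conv
    (h : Integrable (fun p : E d × E d => a (p.1 + p.2) * (F p.1 * G p.2)) (volume.prod volume)) :
    Integrable fun ξ => a ξ * conv F G ξ := by
  refine (integrable_mul_sub h).integral_prod_left.congr (ae_of_all _ fun ξ => ?_)
  simp only [conv]
  rw [integral_const_mul]

theorem locallyIntegrable_conv {N : ℕ}
    (h : Integrable (fun p : E d × E d => (decay N (p.1 + p.2) : ℂ) * (F p.1 * G p.2))
      (volume.prod volume)) :
    LocallyIntegrable (conv F G) volume := by
  have h1 : LocallyIntegrable (fun ξ => (decay N ξ : ℂ) * conv F G ξ) volume :=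
    (integrable_mul_conv (a := fun ξ => (decay N ξ : ℂ)) h).locallyIntegrable
  have h2 : Continuous fun ξ : E d => (((1 + ‖ξ‖ ^ 2) ^ N : ℝ) : ℂ) := by fun_prop
  refine (h1.continuous_mul h2).congr (ae_of_all _ fun ξ => ?_)
  have h3 : (1 + ‖ξ‖ ^ 2) ^ N * decay N ξ = 1 := mul_inv_cancel₀ (by positivity)
  simp only
  rw [← mul_assoc, ← Complex.ofReal_mul, h3, Complex.ofReal_one, one_mul]

theorem exists_fourier_apply_eq_integral_conv {N : ℕ}
    (h : Integrable (fun p : E d × E d => (decay N (p.1 + p.2) : ℂ) * (F p.1 * G p.2))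
      (volume.prod volume)) :
    ∃ T : 𝓢'(E d, ℂ), ∀ ψ : 𝓢(E d, ℂ), 𝓕 T ψ = ∫ ξ, ψ ξ * conv F G ξ := by
  have h1 : MemLp (fun ξ => (decay N ξ : ℂ) * conv F G ξ) 1 volume :=
    memLp_one_iff_integrable.2 (integrable_mul_conv (a := fun ξ => (decay N ξ : ℂ)) h)
  have hg := hasTemperateGrowth_one_add_norm_sq_pow (d := d) N
  refine ⟨𝓕⁻ (TemperedDistribution.smulLeftCLM ℂ
    (fun ξ : E d => (((1 + ‖ξ‖ ^ 2) ^ N : ℝ) : ℂ)) (Lp.toTemperedDistribution (h1.toLp _))),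
    fun ψ => ?_⟩
  rw [FourierTransform.fourier_fourierInv_eq, TemperedDistribution.smulLeftCLM_apply_apply,
    Lp.toTemperedDistribution_apply]
  refine integral_congr_ae ?_
  filter_upwards [h1.coeFn_toLp] with ξ hξ
  have h3 : (1 + ‖ξ‖ ^ 2) ^ N * decay N ξ = 1 := mul_inv_cancel₀ (by positivity)
  rw [hξ, SchwartzMap.smulLeftCLM_apply_apply hg, smul_eq_mul, smul_eq_mul]
  calc _ = (((1 + ‖ξ‖ ^ 2) ^ N : ℝ) : ℂ) * (decay N ξ : ℂ) * (ψ ξ * conv F G ξ) := by ring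
    _ = _ := by rw [← Complex.ofReal_mul, h3, Complex.ofReal_one, one_mul]

theorem integrable_schwartz_mul {N : ℕ} (hF : Measurable F) (hG : Measurable G)
    (h : Integrable (fun p : E d × E d => (decay N (p.1 + p.2) : ℂ) * (F p.1 * G p.2))
      (volume.prod volume)) (b : 𝓢(E d, ℂ)) :
    Integrable (fun p : E d × E d => b (p.1 + p.2) * (F p.1 * G p.2)) (volume.prod volume) := by
  obtain ⟨B, hB, hb⟩ := exists_norm_le_decay b N
  refine (h.norm.const_mul B).mono' ?_ (ae_of_all _ fun p => ?_)
  · exact ((b.continuous.measurable.comp (measurable_fst.add measurable_snd)).mul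
      ((hF.comp measurable_fst).mul (hG.comp measurable_snd))).aestronglyMeasurable
  · rw [norm_mul, norm_mul (decay N _ : ℂ), Complex.norm_real,
      Real.norm_of_nonneg (decay_pos _ _).le, ← mul_assoc]
    gcongr
    exact hb _

/-- The product of two functions with integrable Fourier transforms `u` and `v`, tested against `ψ`:
this is `u ⋆ v` tested against `𝓕⁻ ψ`. -/
theorem integral_mul_fourierInv_mul_fourierInv {u v : E d → ℂ} (hu : Integrable u)
    (hv : Integrable v) (ψ : 𝓢(E d, ℂ)) :
    ∫ x, ψ x * (𝓕⁻ u x * 𝓕⁻ v x) =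
      ∫ p : E d × E d, (𝓕⁻ ψ) (p.1 + p.2) * (u p.1 * v p.2) ∂(volume.prod volume) := by
  set e : E d × (E d × E d) → ℂ := fun q => (Real.fourierChar (inner ℝ (q.2.1 + q.2.2) q.1) : ℂ)
    with he
  have hec : Continuous e := by
    refine continuous_subtype_val.comp (Real.continuous_fourierChar.comp ?_)
    fun_prop
  have hint : Integrable (fun q : E d × (E d × E d) =>
      e q * (ψ q.1 * (u q.2.1 * v q.2.2))) (volume.prod (volume.prod volume)) := by
    refine Integrable.bdd_mul (c := 1) (ψ.integrable.mul_prod (hu.mul_prod hv))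
      hec.aestronglyMeasurable (ae_of_all _ fun q => ?_)
    exact (Circle.norm_coe _).le
  have h1 : ∀ x, ψ x * (𝓕⁻ u x * 𝓕⁻ v x) =
      ∫ p : E d × E d, e (x, p) * (ψ x * (u p.1 * v p.2)) ∂(volume.prod volume) := by
    intro x
    rw [Real.fourierInv_eq, Real.fourierInv_eq, ← integral_prod_mul, ← integral_const_mul]
    refine integral_congr_ae (ae_of_all _ fun p => ?_)
    simp only [he, Circle.smul_def, smul_eq_mul, inner_add_left, AddChar.map_add_eq_mul,
      Circle.coe_mul]
    ring
  have h2 : ∀ p : E d × E d, ∫ x, e (x, p) * (ψ x * (u p.1 * v p.2)) =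
      (𝓕⁻ ψ) (p.1 + p.2) * (u p.1 * v p.2) := by
    intro p
    rw [SchwartzMap.fourierInv_coe, Real.fourierInv_eq, ← integral_mul_const]
    refine integral_congr_ae (ae_of_all _ fun x => ?_)
    simp only [he, Circle.smul_def, smul_eq_mul, real_inner_comm]
    ring
  simp_rw [h1]
  rw [integral_integral_swap hint]
  simp_rw [h2]

/-- The frequency truncations of a convolution converge, by dominated convergence. -/
theorem tendsto_integral_cutoff (hF : Measurable F) (hG : Measurable G) {b : E d → ℂ}
    (hb : Measurable b)
    (hint : Integrable (fun p : E d × E d => b (p.1 + p.2) * (F p.1 * G p.2)) (volume.prod volume))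
    {χ : E d → ℂ} (hχ : Continuous χ) (hχc : HasCompactSupport χ) (hχ1 : χ =ᶠ[𝓝 0] 1) :
    Tendsto (fun n : ℕ => ∫ p : E d × E d, b (p.1 + p.2) *
      ((χ (((2 : ℝ) ^ n)⁻¹ • p.1) * F p.1) * (χ (((2 : ℝ) ^ n)⁻¹ • p.2) * G p.2))
        ∂(volume.prod volume)) atTop
      (𝓝 (∫ p : E d × E d, b (p.1 + p.2) * (F p.1 * G p.2) ∂(volume.prod volume))) := by
  obtain ⟨B, hB⟩ := hχc.exists_bound_of_continuous hχ
  have hB0 : 0 ≤ B := (norm_nonneg _).trans (hB 0)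
  have hχm : Measurable χ := hχ.measurable
  have hdom : Integrable (fun p : E d × E d => B ^ 2 * ‖b (p.1 + p.2) * (F p.1 * G p.2)‖)
      (volume.prod volume) := hint.norm.const_mul _
  refine tendsto_integral_of_dominated_convergence _ (fun n => ?_) hdom (fun n => ?_) ?_
  · have m1 : Measurable fun p : E d × E d => b (p.1 + p.2) :=
      hb.comp (measurable_fst.add measurable_snd)
    have m2 : ∀ L : E d → ℂ, Measurable L → Measurable fun ξ => χ (((2 : ℝ) ^ n)⁻¹ • ξ) * L ξ :=
      fun L hL => by fun_prop
    exact (m1.mul (((m2 F hF).comp measurable_fst).mul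
      ((m2 G hG).comp measurable_snd))).aestronglyMeasurable
  · refine ae_of_all _ fun p => ?_
    simp only [norm_mul]
    have b1 := hB (((2 : ℝ) ^ n)⁻¹ • p.1)
    have b2 := hB (((2 : ℝ) ^ n)⁻¹ • p.2)
    calc _ = ‖χ (((2 : ℝ) ^ n)⁻¹ • p.1)‖ * ‖χ (((2 : ℝ) ^ n)⁻¹ • p.2)‖ *
          (‖b (p.1 + p.2)‖ * (‖F p.1‖ * ‖G p.2‖)) := by ring
      _ ≤ B * B * (‖b (p.1 + p.2)‖ * (‖F p.1‖ * ‖G p.2‖)) := by gcongr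
      _ = _ := by ring
  · have hχt : ∀ ξ : E d, ∀ᶠ n : ℕ in atTop, χ (((2 : ℝ) ^ n)⁻¹ • ξ) = 1 := by
      intro ξ
      have t1 : Tendsto (fun n : ℕ => ((2 : ℝ) ^ n)⁻¹ • ξ) atTop (𝓝 ((0 : ℝ) • ξ)) := by
        refine Tendsto.smul_const ?_ ξ
        simpa only [← inv_pow] using
          tendsto_pow_atTop_nhds_zero_of_lt_one (r := (2 : ℝ)⁻¹) (by norm_num) (by norm_num)
      rw [zero_smul] at t1
      exact t1.eventually hχ1
    refine ae_of_all _ fun p => tendsto_const_nhds.congr' ?_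
    filter_upwards [hχt p.1, hχt p.2] with n h1 h2
    rw [h1, h2, one_mul, one_mul]

/-- The candidate for the product is the distribution whose Fourier transform is `F ⋆ G`. Both sides
are moved to the Fourier side, where the cutoffs act as multipliers on `F` and `G`. -/
theorem isProduct_of_fourier_apply {f g T : 𝓢'(E d, ℂ)} (hf : IsFourierDensity f F)
    (hg : IsFourierDensity g G) (hF : Measurable F) (hG : Measurable G) {N : ℕ}
    (h : Integrable (fun p : E d × E d => (decay N (p.1 + p.2) : ℂ) * (F p.1 * G p.2))
      (volume.prod volume))
    (hT : ∀ ψ : 𝓢(E d, ℂ), 𝓕 T ψ = ∫ ξ, ψ ξ * conv F G ξ) : IsProduct f g T := by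
  refine ⟨F, G, hf, hg, fun χ hχ hχc hχ1 ψ => ?_⟩
  have hint := integrable_schwartz_mul hF hG h (𝓕⁻ ψ)
  have e1 : T ψ = ∫ p : E d × E d, (𝓕⁻ ψ) (p.1 + p.2) * (F p.1 * G p.2) ∂(volume.prod volume) := by
    rw [integral_add_eq_integral_conv hint, ← hT, TemperedDistribution.fourier_apply,
      FourierTransform.fourier_fourierInv_eq]
  have hscale : ∀ n : ℕ, ∀ L : E d → ℂ, LocallyIntegrable L volume →
      Integrable fun ξ => χ (((2 : ℝ) ^ n)⁻¹ • ξ) * L ξ := by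
    intro n L hL
    refine hL.integrable_smul_left_of_hasCompactSupport (g := fun ξ => χ (((2 : ℝ) ^ n)⁻¹ • ξ))
      (hχ.continuous.comp (continuous_const_smul _)) ?_
    exact hχc.comp_smul (by positivity)
  have e2 : ∀ n : ℕ, ∫ x, ψ x * (lowPass χ F n x * lowPass χ G n x) =
      ∫ p : E d × E d, (𝓕⁻ ψ) (p.1 + p.2) * ((χ (((2 : ℝ) ^ n)⁻¹ • p.1) * F p.1) *
        (χ (((2 : ℝ) ^ n)⁻¹ • p.2) * G p.2)) ∂(volume.prod volume) := fun n =>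
    integral_mul_fourierInv_mul_fourierInv (hscale n F hf.1) (hscale n G hg.1) ψ
  simp_rw [e2]
  rw [e1]
  exact tendsto_integral_cutoff hF hG (𝓕⁻ ψ).continuous.measurable hint hχ.continuous hχc hχ1

/-- Plancherel's theorem for a Littlewood-Paley block. -/
theorem l2Norm_lpBlock_le {T : 𝓢'(E d, ℂ)} {H : E d → ℂ} (hH : AEStronglyMeasurable H volume)
    (hT : ∀ ψ : 𝓢(E d, ℂ), 𝓕 T ψ = ∫ ξ, ψ ξ * H ξ) (φ : 𝓢(E d, ℝ)) (j : ℤ) :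
    l2Norm (lpBlock φ j T) ≤ eLpNorm (fun ξ => dyadicSymbol φ j ξ * H ξ) 2 volume := by
  by_cases htop : eLpNorm (fun ξ => dyadicSymbol φ j ξ * H ξ) 2 volume = ⊤
  · rw [htop]
    exact le_top
  have hφ := dyadicSymbol_hasTemperateGrowth φ j
  have hmem : MemLp (fun ξ => dyadicSymbol φ j ξ * H ξ) 2 volume :=
    ⟨hφ.1.continuous.aestronglyMeasurable.mul hH, lt_top_iff_ne_top.2 htop⟩
  have e1 : Lp.toTemperedDistribution (hmem.toLp _) =
      TemperedDistribution.smulLeftCLM ℂ (dyadicSymbol φ j) (𝓕 T) := by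
    ext ψ
    rw [Lp.toTemperedDistribution_apply, TemperedDistribution.smulLeftCLM_apply_apply, hT]
    refine integral_congr_ae ?_
    filter_upwards [hmem.coeFn_toLp] with ξ hξ
    rw [hξ, SchwartzMap.smulLeftCLM_apply_apply hφ, smul_eq_mul, smul_eq_mul]
    ring
  have e2 : Lp.toTemperedDistribution (𝓕⁻ (hmem.toLp _)) = lpBlock φ j T := by
    rw [← Lp.fourierInv_toTemperedDistribution_eq, e1]
    rfl
  have e3 : ‖𝓕⁻ (hmem.toLp _)‖ₑ = eLpNorm (fun ξ => dyadicSymbol φ j ξ * H ξ) 2 volume := by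
    rw [← ofReal_norm, ← Lp.norm_fourier_eq, FourierTransform.fourier_fourierInv_eq,
      ofReal_norm, Lp.enorm_toLp]
  unfold l2Norm
  exact (iInf₂_le (𝓕⁻ (hmem.toLp _)) e2).trans e3.le

end Conv

/-! ### Temperate growth of the convolution -/

theorem decay_add {d : ℕ} (M N : ℕ) (ξ : E d) : decay (M + N) ξ = decay M ξ * decay N ξ := by
  simp only [decay, pow_add, mul_inv]

theorem decay_le_one {d : ℕ} (N : ℕ) (ξ : E d) : decay N ξ ≤ 1 :=
  inv_le_one_of_one_le₀ (one_le_pow₀ (by nlinarith [sq_nonneg ‖ξ‖]))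

theorem decay_le_decay {d : ℕ} {M N : ℕ} (h : M ≤ N) (ξ : E d) : decay N ξ ≤ decay M ξ := by
  obtain ⟨k, rfl⟩ := Nat.exists_eq_add_of_le h
  rw [decay_add]
  exact mul_le_of_le_one_right (decay_pos M ξ).le (decay_le_one k ξ)

theorem lintegral_decay_lt_top {d N : ℕ} (hd : 1 ≤ d) (hN : d ≤ N) :
    ∫⁻ ξ : E d, ENNReal.ofReal (decay N ξ) < ⊤ := by
  have hN' : (d : ℝ) ≤ N := by exact_mod_cast hN
  have hd' : (1 : ℝ) ≤ d := by exact_mod_cast hd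
  have h : Integrable (fun ξ : E d => ((1 : ℝ) + ‖ξ‖ ^ 2) ^ (-(2 * (N : ℝ)) / 2)) volume := by
    refine integrable_rpow_neg_one_add_norm_sq ?_
    rw [finrank_euclideanSpace_fin]
    linarith
  have e : ∀ ξ : E d, ((1 : ℝ) + ‖ξ‖ ^ 2) ^ (-(2 * (N : ℝ)) / 2) = decay N ξ := by
    intro ξ
    rw [show -(2 * (N : ℝ)) / 2 = -(N : ℝ) by ring, Real.rpow_neg (by positivity),
      Real.rpow_natCast, decay]
  simp_rw [e] at h
  exact h.lintegral_lt_top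

/-- Away from the origin, weights are bounded below by a negative power. -/
theorem exists_decay_le_weight {w : ℝ → ℝ} (hw : IsWeight w) (s : ℝ) :
    ∃ M : ℕ, ∃ B : ℝ, 0 < B ∧ ∀ d : ℕ, ∀ ζ : E d, 1 ≤ ‖ζ‖ →
      decay M ζ ≤ B * (‖ζ‖ ^ s * w ‖ζ‖) := by
  obtain ⟨K, hK, hcomp⟩ := hw.le_mul_of_comparable one_pos
  obtain ⟨M, hM⟩ := exists_nat_ge (|s| + 1)
  have hw1 := hw.pos zero_le_one
  refine ⟨M, K / w 1, by positivity, fun d ζ hζ => ?_⟩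
  set x := ‖ζ‖ with hx
  have hx0 : 0 < x := by linarith
  have hwx := hw.pos hx0.le
  have h1 : w 1 ≤ K * x ^ (1 : ℝ) * w x := hcomp 1 x x one_pos hx0 (by nlinarith) (by linarith)
  have h2 : 1 ≤ x ^ |s| * x ^ s := by
    rw [← Real.rpow_add hx0]
    exact Real.one_le_rpow hζ (by linarith [neg_abs_le s])
  have h3 : x ^ |s| * x ^ (1 : ℝ) ≤ (1 + x ^ 2) ^ M := by
    rw [← Real.rpow_add hx0, ← Real.rpow_natCast]
    calc x ^ (|s| + 1) ≤ (1 + x ^ 2) ^ (|s| + 1) :=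
          Real.rpow_le_rpow hx0.le (by nlinarith) (by positivity)
      _ ≤ _ := Real.rpow_le_rpow_of_exponent_le (by nlinarith) hM
  have hxs : 0 < x ^ s := by positivity
  rw [decay, inv_le_iff_one_le_mul₀ (by positivity)]
  calc (1 : ℝ) = w 1 / w 1 := by field_simp
    _ ≤ (K * x ^ (1 : ℝ) * w x * (x ^ |s| * x ^ s)) / w 1 := by
        gcongr
        exact h1.trans (le_mul_of_one_le_right (by positivity) h2)
    _ = K / w 1 * (x ^ s * w x) * (x ^ |s| * x ^ (1 : ℝ)) := by ring
    _ ≤ _ := by gcongr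

/-- Near the origin this is local integrability, away from it the Cauchy-Schwarz inequality. -/
theorem exists_lintegral_decay_mul_lt_top {d : ℕ} (hd : 1 ≤ d) {w : ℝ → ℝ} (hw : IsWeight w)
    (s : ℝ) {F : E d → ℂ} (hF : Measurable F) (hFl : LocallyIntegrable F volume)
    (hfin : ∫⁻ ζ, weightedSq (fun r => r ^ s * w r) (fun ζ => ‖F ζ‖ₑ) ζ < ⊤) :
    ∃ N₀ : ℕ, ∀ N, N₀ ≤ N → ∫⁻ ζ, ENNReal.ofReal (decay N ζ) * ‖F ζ‖ₑ < ⊤ := by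
  obtain ⟨M, B, hB, hle⟩ := exists_decay_le_weight hw s
  refine ⟨M + d, fun N hN => ?_⟩
  have hdm : ∀ n, Measurable (decay n : E d → ℝ) := fun n => (continuous_decay n).measurable
  have hpm := measurable_rpow_mul_weight (d := d) hw s
  rw [← lintegral_add_compl _ (measurableSet_closedBall (x := (0 : E d)) (ε := 1))]
  refine ENNReal.add_lt_top.2 ⟨?_, ?_⟩
  · refine lt_of_le_of_lt (lintegral_mono fun ζ => ?_)
      (hFl.integrableOn_isCompact (isCompact_closedBall (0 : E d) 1)).2
    exact mul_le_of_le_one_left zero_le (ENNReal.ofReal_le_one.2 (decay_le_one N ζ))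
  · have h1 : ∫⁻ ζ in (Metric.closedBall (0 : E d) 1)ᶜ, ENNReal.ofReal (decay N ζ) * ‖F ζ‖ₑ ≤
        ENNReal.ofReal B * ∫⁻ ζ, ENNReal.ofReal (decay d ζ) *
          (ENNReal.ofReal (‖ζ‖ ^ s * w ‖ζ‖) * ‖F ζ‖ₑ) := by
      rw [← lintegral_const_mul' _ _ ENNReal.ofReal_ne_top]
      refine le_trans (setLIntegral_mono' measurableSet_closedBall.compl fun ζ hζ => ?_)
        (setLIntegral_le_lintegral _ _)
      have hζ' : 1 ≤ ‖ζ‖ := by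
        simp only [mem_compl_iff, mem_closedBall_zero_iff, not_le] at hζ
        exact hζ.le
      have h2 : decay N ζ ≤ B * (decay d ζ * (‖ζ‖ ^ s * w ‖ζ‖)) := by
        calc decay N ζ ≤ decay M ζ * decay d ζ := by
              rw [← decay_add]
              exact decay_le_decay hN ζ
          _ ≤ (B * (‖ζ‖ ^ s * w ‖ζ‖)) * decay d ζ :=
              mul_le_mul_of_nonneg_right (hle d ζ hζ') (decay_pos d ζ).le
          _ = _ := by ring
      calc ENNReal.ofReal (decay N ζ) * ‖F ζ‖ₑ
          ≤ ENNReal.ofReal (B * (decay d ζ * (‖ζ‖ ^ s * w ‖ζ‖))) * ‖F ζ‖ₑ := by gcongr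
        _ = _ := by
          rw [ENNReal.ofReal_mul hB.le, ENNReal.ofReal_mul (decay_pos d ζ).le]
          ring
    refine lt_of_le_of_lt h1 (ENNReal.mul_lt_top ENNReal.ofReal_lt_top ?_)
    have hCS := sq_lintegral_mul_le (volume : Measure (E d))
      (f := fun ζ => ENNReal.ofReal (decay d ζ))
      (g := fun ζ => ENNReal.ofReal (‖ζ‖ ^ s * w ‖ζ‖) * ‖F ζ‖ₑ)
      (hdm d).ennreal_ofReal.aemeasurable (hpm.ennreal_ofReal.mul hF.enorm).aemeasurable
    have h3 : ∫⁻ ζ : E d, ENNReal.ofReal (decay d ζ) ^ 2 < ⊤ := by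
      refine lt_of_le_of_lt (lintegral_mono fun ζ => ?_) (lintegral_decay_lt_top hd le_rfl)
      rw [sq]
      exact mul_le_of_le_one_left zero_le (ENNReal.ofReal_le_one.2 (decay_le_one d ζ))
    have h4 := lt_of_le_of_lt hCS (ENNReal.mul_lt_top h3 hfin)
    exact (ENNReal.pow_lt_top_iff.1 h4).resolve_right two_ne_zero

/-- Unless `ζ` and `η` are large and comparable, no cancellation occurs in `ζ + η`. -/
theorem decay_add_le {d : ℕ} (M : ℕ) {ζ η : E d}
    (h : ¬ (1 ≤ ‖ζ‖ ∧ ‖ζ‖ ≤ 2 * ‖η‖ ∧ ‖η‖ ≤ 2 * ‖ζ‖)) :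
    decay (2 * M) (ζ + η) ≤ 16 ^ M * (decay M ζ * decay M η) := by
  have n1 : ‖ζ‖ - ‖η‖ ≤ ‖ζ + η‖ := by
    have := norm_sub_norm_le ζ (-η)
    rwa [norm_neg, sub_neg_eq_add] at this
  have n2 : ‖η‖ - ‖ζ‖ ≤ ‖ζ + η‖ := by
    have := norm_sub_norm_le η (-ζ)
    rwa [norm_neg, sub_neg_eq_add, add_comm η] at this
  have hζ := norm_nonneg ζ
  have hη := norm_nonneg η
  have hc := norm_nonneg (ζ + η)
  set a := ‖ζ‖
  set b := ‖η‖
  set c := ‖ζ + η‖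
  have key : (1 + a ^ 2) * (1 + b ^ 2) ≤ 16 * (1 + c ^ 2) ^ 2 := by
    have big : ∀ x y : ℝ, 0 ≤ y → y ≤ x → x ≤ 2 * c →
        (1 + x ^ 2) * (1 + y ^ 2) ≤ 16 * (1 + c ^ 2) ^ 2 := by
      intro x y hy hyx hxc
      have h1 : 1 + x ^ 2 ≤ 4 * (1 + c ^ 2) := by nlinarith
      have h2 : 1 + y ^ 2 ≤ 4 * (1 + c ^ 2) := by nlinarith
      calc _ ≤ (4 * (1 + c ^ 2)) * (4 * (1 + c ^ 2)) := by gcongr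
        _ = _ := by ring
    by_cases h1 : a ≤ 2 * b
    · by_cases h2 : b ≤ 2 * a
      · have h3 : a < 1 := by
          by_contra h3
          exact h ⟨not_lt.1 h3, h1, h2⟩
        have h4 : 1 + a ^ 2 ≤ 2 := by nlinarith
        have h5 : 1 + b ^ 2 ≤ 5 := by nlinarith
        calc _ ≤ (2 : ℝ) * 5 := by gcongr
          _ ≤ _ := by nlinarith [sq_nonneg c, sq_nonneg (c ^ 2)]
      · rw [mul_comm]
        exact big b a hζ (by linarith) (by linarith)
    · exact big a b hη (by linarith) (by linarith)
  change ((1 + c ^ 2) ^ (2 * M))⁻¹ ≤ 16 ^ M * (((1 + a ^ 2) ^ M)⁻¹ * ((1 + b ^ 2) ^ M)⁻¹)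
  rw [← mul_inv, ← mul_pow, ← div_eq_mul_inv, le_div_iff₀ (by positivity),
    inv_mul_le_iff₀ (by positivity), pow_mul, ← mul_pow, mul_comm _ (16 : ℝ)]
  gcongr

/-- The convolution of `F` and `G` converges absolutely and defines a tempered distribution. For
large comparable frequencies this rests on `s + s' > 0`. -/
theorem exists_integrable_decay_mul {d : ℕ} (hd : 1 ≤ d) {s s' : ℝ} (hss' : 0 < s + s')
    {w w' : ℝ → ℝ} (hw : IsWeight w) (hw' : IsWeight w') {F G : E d → ℂ} (hF : Measurable F)
    (hG : Measurable G) (hFl : LocallyIntegrable F volume) (hGl : LocallyIntegrable G volume)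
    (hFfin : ∫⁻ ζ, weightedSq (fun r => r ^ s * w r) (fun ζ => ‖F ζ‖ₑ) ζ < ⊤)
    (hGfin : ∫⁻ ζ, weightedSq (fun r => r ^ s' * w' r) (fun ζ => ‖G ζ‖ₑ) ζ < ⊤) :
    ∃ N : ℕ, Integrable (fun p : E d × E d => (decay N (p.1 + p.2) : ℂ) * (F p.1 * G p.2))
      (volume.prod volume) := by
  obtain ⟨N₁, h₁⟩ := exists_lintegral_decay_mul_lt_top hd hw s hF hFl hFfin
  obtain ⟨N₂, h₂⟩ := exists_lintegral_decay_mul_lt_top hd hw' s' hG hGl hGfin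
  obtain ⟨K, hK, hweight⟩ := weight_mul_weight_le hss' hw hw'
  set M := max d (max N₁ N₂) with hM
  have hFM := h₁ M (by omega)
  have hGM := h₂ M (by omega)
  have hdM := lintegral_decay_lt_top (N := 2 * M) hd (by omega)
  have hdm : ∀ n, Measurable (decay n : E d → ℝ) := fun n => (continuous_decay n).measurable
  have hdm' : Measurable fun p : E d × E d => ENNReal.ofReal (decay (2 * M) (p.1 + p.2)) :=
    ((hdm (2 * M)).comp (measurable_fst.add measurable_snd)).ennreal_ofReal
  set U := weightedSq (fun r => r ^ s * w r) (fun ζ => ‖F ζ‖ₑ) with hU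
  set V := weightedSq (fun r => r ^ s' * w' r) (fun ζ => ‖G ζ‖ₑ) with hV
  have hUm : Measurable U := measurable_weightedSq (measurable_rpow_mul_weight hw s) hF.enorm
  have hVm : Measurable V := measurable_weightedSq (measurable_rpow_mul_weight hw' s') hG.enorm
  have hw1 : 0 < w 1 * w' 1 := mul_pos (hw.pos zero_le_one) (hw'.pos zero_le_one)
  set B := K / (w 1 * w' 1) with hB
  have hB0 : 0 < B := by positivity
  refine ⟨2 * M, ?_, ?_⟩
  · refine Measurable.aestronglyMeasurable (Measurable.mul ?_
      ((hF.comp measurable_fst).mul (hG.comp measurable_snd)))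
    exact Complex.measurable_ofReal.comp ((hdm _).comp (measurable_fst.add measurable_snd))
  have hbound : ∀ p : E d × E d, ‖(decay (2 * M) (p.1 + p.2) : ℂ) * (F p.1 * G p.2)‖ₑ ≤
      ENNReal.ofReal (16 ^ M) * ((ENNReal.ofReal (decay M p.1) * ‖F p.1‖ₑ) *
        (ENNReal.ofReal (decay M p.2) * ‖G p.2‖ₑ)) +
      ENNReal.ofReal B * (ENNReal.ofReal (decay (2 * M) (p.1 + p.2)) * U p.1 +
        ENNReal.ofReal (decay (2 * M) (p.1 + p.2)) * V p.2) := by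
    rintro ⟨ζ, η⟩
    have e : ‖(decay (2 * M) (ζ + η) : ℂ) * (F ζ * G η)‖ₑ =
        ENNReal.ofReal (decay (2 * M) (ζ + η)) * (‖F ζ‖ₑ * ‖G η‖ₑ) := by
      rw [enorm_mul, enorm_mul, ← ofReal_norm (decay (2 * M) (ζ + η) : ℂ), Complex.norm_real,
        Real.norm_of_nonneg (decay_pos _ _).le]
    rw [e]
    by_cases hc : 1 ≤ ‖ζ‖ ∧ ‖ζ‖ ≤ 2 * ‖η‖ ∧ ‖η‖ ≤ 2 * ‖ζ‖
    · refine le_add_left ?_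
      obtain ⟨c1, c2, c3⟩ := hc
      have hζ0 : 0 < ‖ζ‖ := by linarith
      have hη0 : 0 < ‖η‖ := by linarith
      have hp : 0 < ‖ζ‖ ^ s * w ‖ζ‖ := mul_pos (by positivity) (hw.pos hζ0.le)
      have hq : 0 < ‖η‖ ^ s' * w' ‖η‖ := mul_pos (by positivity) (hw'.pos hη0.le)
      have hB1 : 1 ≤ B * ((‖ζ‖ ^ s * w ‖ζ‖) * (‖η‖ ^ s' * w' ‖η‖)) := by
        have := hweight 1 1 ‖ζ‖ ‖η‖ one_pos (by norm_num) (by norm_num) (by linarith)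
          (by linarith) (by linarith)
        rw [Real.one_rpow, Real.one_rpow, one_mul, one_mul] at this
        have h3 : (1 / ‖ζ‖) ^ ((s + s') / 2) ≤ 1 :=
          Real.rpow_le_one (by positivity) ((div_le_one hζ0).2 c1) (by linarith)
        rw [hB, div_mul_eq_mul_div, one_le_div hw1]
        exact this.trans
          (mul_le_mul_of_nonneg_left (mul_le_of_le_one_left (by positivity) h3) hK.le)
      have hFG : ‖F ζ‖ₑ * ‖G η‖ₑ ≤ ENNReal.ofReal B * (U ζ + V η) := by
        have hab : ∀ a b : ℝ≥0∞, a * b ≤ a ^ 2 + b ^ 2 := by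
          intro a b
          rcases le_total a b with hh | hh
          · exact le_add_left ((mul_le_mul' hh le_rfl).trans (sq b).ge)
          · exact le_add_right ((mul_le_mul' le_rfl hh).trans (sq a).ge)
        calc ‖F ζ‖ₑ * ‖G η‖ₑ
            ≤ ENNReal.ofReal (B * ((‖ζ‖ ^ s * w ‖ζ‖) * (‖η‖ ^ s' * w' ‖η‖))) *
              (‖F ζ‖ₑ * ‖G η‖ₑ) :=
              le_mul_of_one_le_left zero_le (ENNReal.one_le_ofReal.2 hB1)
          _ = ENNReal.ofReal B * ((ENNReal.ofReal (‖ζ‖ ^ s * w ‖ζ‖) * ‖F ζ‖ₑ) *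
              (ENNReal.ofReal (‖η‖ ^ s' * w' ‖η‖) * ‖G η‖ₑ)) := by
              rw [ENNReal.ofReal_mul hB0.le, ENNReal.ofReal_mul hp.le]
              ring
          _ ≤ _ := by
              gcongr
              exact hab _ _
      calc _ ≤ ENNReal.ofReal (decay (2 * M) (ζ + η)) * (ENNReal.ofReal B * (U ζ + V η)) := by
            gcongr
        _ = _ := by ring
    · refine le_add_right ?_
      calc _ ≤ ENNReal.ofReal (16 ^ M * (decay M ζ * decay M η)) * (‖F ζ‖ₑ * ‖G η‖ₑ) := by
            gcongr
            exact decay_add_le M hc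
        _ = _ := by
            rw [ENNReal.ofReal_mul (by positivity), ENNReal.ofReal_mul (decay_pos M ζ).le]
            ring
  have hA : ∫⁻ p : E d × E d, (ENNReal.ofReal (decay M p.1) * ‖F p.1‖ₑ) *
      (ENNReal.ofReal (decay M p.2) * ‖G p.2‖ₑ) ∂(volume.prod volume) < ⊤ := by
    have m : ∀ L : E d → ℂ, Measurable L →
        Measurable fun ζ => ENNReal.ofReal (decay M ζ) * ‖L ζ‖ₑ :=
      fun L hL => (hdm M).ennreal_ofReal.mul hL.enorm
    rw [lintegral_prod_mul (m F hF).aemeasurable (m G hG).aemeasurable]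
    exact ENNReal.mul_lt_top hFM hGM
  have mU : Measurable fun p : E d × E d => ENNReal.ofReal (decay (2 * M) (p.1 + p.2)) * U p.1 :=
    hdm'.mul (hUm.comp measurable_fst)
  have mV : Measurable fun p : E d × E d => ENNReal.ofReal (decay (2 * M) (p.1 + p.2)) * V p.2 :=
    hdm'.mul (hVm.comp measurable_snd)
  have hIU : ∫⁻ p : E d × E d, ENNReal.ofReal (decay (2 * M) (p.1 + p.2)) * U p.1
      ∂(volume.prod volume) < ⊤ := by
    rw [lintegral_prod _ mU.aemeasurable]
    have e : ∀ ζ : E d, ∫⁻ η, ENNReal.ofReal (decay (2 * M) (ζ + η)) * U ζ =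
        (∫⁻ ξ : E d, ENNReal.ofReal (decay (2 * M) ξ)) * U ζ := by
      intro ζ
      rw [lintegral_mul_const'' _ (by fun_prop),
        lintegral_add_left_eq_self (fun ξ => ENNReal.ofReal (decay (2 * M) ξ)) ζ]
    simp_rw [e]
    rw [lintegral_const_mul _ hUm]
    exact ENNReal.mul_lt_top hdM hFfin
  have hIV : ∫⁻ p : E d × E d, ENNReal.ofReal (decay (2 * M) (p.1 + p.2)) * V p.2
      ∂(volume.prod volume) < ⊤ := by
    rw [lintegral_prod_symm _ mV.aemeasurable]
    have e : ∀ η : E d, ∫⁻ ζ, ENNReal.ofReal (decay (2 * M) (ζ + η)) * V η =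
        (∫⁻ ξ : E d, ENNReal.ofReal (decay (2 * M) ξ)) * V η := by
      intro η
      rw [lintegral_mul_const'' _ (by fun_prop),
        lintegral_add_right_eq_self (fun ξ => ENNReal.ofReal (decay (2 * M) ξ)) η]
    simp_rw [e]
    rw [lintegral_const_mul _ hVm]
    exact ENNReal.mul_lt_top hdM hGfin
  refine lt_of_le_of_lt (lintegral_mono hbound) ?_
  have mUV : Measurable fun p : E d × E d =>
      ENNReal.ofReal B * (ENNReal.ofReal (decay (2 * M) (p.1 + p.2)) * U p.1 +
        ENNReal.ofReal (decay (2 * M) (p.1 + p.2)) * V p.2) := (mU.add mV).const_mul _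
  rw [lintegral_add_right _ mUV,
    lintegral_const_mul' _ _ ENNReal.ofReal_ne_top, lintegral_const_mul' _ _ ENNReal.ofReal_ne_top,
    lintegral_add_left mU]
  exact ENNReal.add_lt_top.2 ⟨ENNReal.mul_lt_top ENNReal.ofReal_lt_top hA,
    ENNReal.mul_lt_top ENNReal.ofReal_lt_top (ENNReal.add_lt_top.2 ⟨hIU, hIV⟩)⟩

/-! ### Dyadic annuli and weighted norms -/

theorem eLpNorm_two_sq {α : Type*} [MeasurableSpace α] (μ : Measure α) (u : α → ℂ) :
    eLpNorm u 2 μ ^ 2 = ∫⁻ a, ‖u a‖ₑ ^ 2 ∂μ := by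
  rw [eLpNorm_eq_lintegral_rpow_enorm_toReal two_ne_zero ENNReal.ofNat_ne_top,
    ← ENNReal.rpow_mul_natCast]
  simp

theorem IsFourierDensity.congr {d : ℕ} {f : 𝓢'(E d, ℂ)} {F G : E d → ℂ}
    (hF : IsFourierDensity f F) (h : F =ᵐ[volume] G) : IsFourierDensity f G := by
  refine ⟨hF.1.congr h, fun φ hφ => (hF.2 φ hφ).trans (integral_congr_ae ?_)⟩
  filter_upwards [h] with ξ hξ
  rw [hξ]

/-- Finiteness of the norm provides a locally integrable density, since an infimum over the empty
set is `∞`. -/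
theorem exists_measurable_density {d : ℕ} {σ : ℝ} {w : ℝ → ℝ} {f : 𝓢'(E d, ℂ)}
    (h : homNorm σ w f < ⊤) : ∃ F : E d → ℂ, Measurable F ∧ IsFourierDensity f F := by
  have hex : ∃ F : E d → ℂ, IsFourierDensity f F := by
    by_contra hne
    simp only [not_exists] at hne
    simp [homNorm, hne] at h
  obtain ⟨F, hF⟩ := hex
  have hm := hF.1.aestronglyMeasurable
  exact ⟨hm.mk F, hm.stronglyMeasurable_mk.measurable, hF.congr hm.ae_eq_mk⟩

theorem eLpNorm_weight_mul_sq {d : ℕ} {p : ℝ → ℝ} (hp : ∀ r, 0 ≤ r → 0 ≤ p r) (F : E d → ℂ) :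
    eLpNorm (fun ξ => ((p ‖ξ‖ : ℝ) : ℂ) * F ξ) 2 volume ^ 2 =
      ∫⁻ ζ, weightedSq p (fun ζ => ‖F ζ‖ₑ) ζ := by
  rw [eLpNorm_two_sq]
  refine lintegral_congr fun ζ => ?_
  rw [enorm_mul, weightedSq, ← ofReal_norm (p ‖ζ‖ : ℂ), Complex.norm_real,
    Real.norm_of_nonneg (hp _ (norm_nonneg ζ))]

theorem homNorm_sq {d : ℕ} {σ : ℝ} {w : ℝ → ℝ} (hw : IsWeight w) {f : 𝓢'(E d, ℂ)}
    {F : E d → ℂ} (hF : IsFourierDensity f F) :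
    homNorm σ w f ^ 2 = ∫⁻ ζ, weightedSq (fun r => r ^ σ * w r) (fun ζ => ‖F ζ‖ₑ) ζ := by
  rw [homNorm_eq σ w hF]
  refine eLpNorm_weight_mul_sq (p := fun r => r ^ σ * w r) (fun r hr => ?_) F
  have := hw.pos hr
  positivity

theorem lowNorm_sq {d : ℕ} {σ : ℝ} {w : ℝ → ℝ} (hw : IsWeight w) {f : 𝓢'(E d, ℂ)}
    {F : E d → ℂ} (hF : IsFourierDensity f F) :
    lowNorm σ w f ^ 2 = ∫⁻ ζ, weightedSq (lowWeight d σ w) (fun ζ => ‖F ζ‖ₑ) ζ := by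
  unfold lowNorm lowWeight
  split_ifs
  · exact homNorm_sq hw hF
  · rw [inhomNorm_eq σ w hF]
    refine eLpNorm_weight_mul_sq (p := fun r => (1 + r ^ 2) ^ (σ / 2) * w r) (fun r hr => ?_) F
    have := hw.pos hr
    positivity

/-- The annulus `2^{j-1} < |ξ| < 2^{j+1}`, which contains the support of `φ(2^{-j} ·)`. -/
def dyadicAnnulus (d : ℕ) (j : ℤ) : Set (E d) :=
  {ξ | (2 : ℝ) ^ (j - 1) < ‖ξ‖ ∧ ‖ξ‖ < (2 : ℝ) ^ (j + 1)}

theorem measurableSet_dyadicAnnulus (d : ℕ) (j : ℤ) : MeasurableSet (dyadicAnnulus d j) := by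
  have m1 : MeasurableSet {ξ : E d | (2 : ℝ) ^ (j - 1) < ‖ξ‖} :=
    measurableSet_lt measurable_const measurable_norm
  have m2 : MeasurableSet {ξ : E d | ‖ξ‖ < (2 : ℝ) ^ (j + 1)} :=
    measurableSet_lt measurable_norm measurable_const
  exact m1.inter m2

/-- Each point lies in at most two of the annuli. -/
theorem tsum_lintegral_dyadicAnnulus_le {d : ℕ} (A : E d → ℝ≥0∞) :
    ∑' j : ℤ, ∫⁻ ξ in dyadicAnnulus d j, A ξ ≤ 2 * ∫⁻ ξ, A ξ := by
  set S : ℤ → Set (E d) := fun j => {ξ | ‖ξ‖ ∈ Ioc ((2 : ℝ) ^ j) ((2 : ℝ) ^ (j + 1))} with hS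
  have hSm : ∀ j, MeasurableSet (S j) := fun j => measurable_norm measurableSet_Ioc
  have hmono : Monotone fun j : ℤ => (2 : ℝ) ^ j := fun i j hij =>
    zpow_le_zpow_right₀ one_le_two hij
  have hdisj : Pairwise (Function.onFun Disjoint S) := fun i j hij =>
    (hmono.pairwise_disjoint_on_Ioc_succ hij).preimage norm
  have hsum : ∑' j, ∫⁻ ξ in S j, A ξ ≤ ∫⁻ ξ, A ξ := by
    rw [← lintegral_iUnion hSm hdisj]
    exact setLIntegral_le_lintegral _ _
  have hshift : ∑' j : ℤ, ∫⁻ ξ in S (j - 1), A ξ = ∑' j, ∫⁻ ξ in S j, A ξ :=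
    (Equiv.subRight (1 : ℤ)).tsum_eq fun j => ∫⁻ ξ in S j, A ξ
  calc ∑' j : ℤ, ∫⁻ ξ in dyadicAnnulus d j, A ξ
      ≤ ∑' j : ℤ, ((∫⁻ ξ in S (j - 1), A ξ) + ∫⁻ ξ in S j, A ξ) := by
        refine ENNReal.tsum_le_tsum fun j => ?_
        refine (lintegral_mono_set fun ξ hξ => ?_).trans (lintegral_union_le A _ _)
        rcases le_or_gt ‖ξ‖ ((2 : ℝ) ^ j) with h | h
        · refine Or.inl ⟨hξ.1, ?_⟩
          rwa [sub_add_cancel]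
        · exact Or.inr ⟨h, hξ.2.le⟩
    _ ≤ (∫⁻ ξ, A ξ) + ∫⁻ ξ, A ξ := by
        rw [ENNReal.tsum_add, hshift]
        gcongr
    _ = _ := (two_mul _).symm

/-- The normalised sequence `e j = α j / P`, or `e = 0` if `P = 0`. -/
theorem exists_summable_le_mul {α : ℤ → ℝ≥0∞} {P : ℝ≥0∞} (hP : P ≠ ⊤) (h : ∑' j, α j ≤ P) :
    ∃ e : ℤ → ℝ, (∀ j, 0 ≤ e j) ∧ Summable e ∧ ∑' j, e j ≤ 1 ∧
      ∀ j, α j ≤ ENNReal.ofReal (e j) * P := by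
  by_cases hP0 : P = 0
  · refine ⟨0, fun _ => le_rfl, summable_zero, by simp, fun j => ?_⟩
    have : α j ≤ 0 := (ENNReal.le_tsum j).trans (h.trans hP0.le)
    exact this.trans zero_le
  have hsum : ∑' j, α j / P ≤ 1 := by
    simp_rw [div_eq_mul_inv]
    rw [ENNReal.tsum_mul_right, ← div_eq_mul_inv]
    exact ENNReal.div_le_of_le_mul (by rwa [one_mul])
  have hne : ∀ j, α j / P ≠ ⊤ := fun j =>
    ne_top_of_le_ne_top ENNReal.one_ne_top ((ENNReal.le_tsum j).trans hsum)
  refine ⟨fun j => (α j / P).toReal, fun j => ENNReal.toReal_nonneg,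
    ENNReal.summable_toReal (ne_top_of_le_ne_top ENNReal.one_ne_top hsum), ?_, fun j => ?_⟩
  · rw [← ENNReal.tsum_toReal_eq hne]
    exact ENNReal.toReal_mono ENNReal.one_ne_top hsum
  · rw [ENNReal.ofReal_toReal (hne j), ENNReal.div_mul_cancel hP0 hP]

theorem IsDyadicGenerator.le_one {d : ℕ} {φ : 𝓢(E d, ℝ)} (hφ : IsDyadicGenerator φ) {ξ : E d}
    (hξ : ξ ≠ 0) : φ ξ ≤ 1 := by
  have h := le_hasSum (hφ.hasSum_one ξ hξ) 0 fun j _ => hφ.nonneg _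
  simpa using h

theorem enorm_dyadicSymbol_le {d : ℕ} {φ : 𝓢(E d, ℝ)} (hφ : IsDyadicGenerator φ) (j : ℤ)
    (ξ : E d) :
    ‖dyadicSymbol φ j ξ‖ₑ ≤ (dyadicAnnulus d j).indicator 1 ξ := by
  have h2 : (0 : ℝ) < 2 ^ j := by positivity
  by_cases hs : (2 : ℝ) ^ (-j) • ξ ∈ tsupport φ
  · obtain ⟨h3, h4⟩ := hφ.tsupport_subset hs
    rw [norm_smul, Real.norm_of_nonneg (by positivity), zpow_neg] at h3 h4
    rw [inv_mul_eq_div] at h3 h4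
    rw [lt_div_iff₀ h2] at h3
    rw [div_lt_iff₀ h2] at h4
    have hmem : ξ ∈ dyadicAnnulus d j := by
      refine ⟨?_, ?_⟩
      · rw [zpow_sub_one₀ two_ne_zero]
        linarith
      · rw [zpow_add_one₀ two_ne_zero]
        linarith
    have hne : (2 : ℝ) ^ (-j) • ξ ≠ 0 := by
      refine smul_ne_zero (by positivity) fun h0 => ?_
      rw [h0, norm_zero] at h3
      linarith
    rw [indicator_of_mem hmem, Pi.one_apply, dyadicSymbol, ← ofReal_norm, Complex.norm_real,
      Real.norm_of_nonneg (hφ.nonneg _)]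
    exact ENNReal.ofReal_le_one.2 (hφ.le_one hne)
  · rw [dyadicSymbol, image_eq_zero_of_notMem_tsupport hs]
    simp

/-! ### The product estimate -/

theorem sum_three_sq_le (a b c : ℝ≥0∞) : a ^ 2 + b ^ 2 + c ^ 2 ≤ (a + b + c) ^ 2 := by
  calc a ^ 2 + b ^ 2 + c ^ 2 ≤ a ^ 2 + b ^ 2 + c ^ 2 + 2 * (a * b + b * c + c * a) := le_self_add
    _ = _ := by ring

/-- A square-summable sequence that controls all dyadic annuli at once is obtained by averaging the
normalised masses of the three densities. -/
theorem exists_annulus_bound {d : ℕ} {H A₁ A₂ A₃ : E d → ℝ≥0∞}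
    (m₁ : Measurable A₁) (m₂ : Measurable A₂) {P₁ P₂ P₃ : ℝ≥0∞}
    (hP₁ : P₁ ≠ ⊤) (hP₂ : P₂ ≠ ⊤) (hP₃ : P₃ ≠ ⊤) {K : ℝ} (hK : 0 ≤ K)
    (hA₁ : ∫⁻ ξ, A₁ ξ ≤ ENNReal.ofReal K * P₁ ^ 2) (hA₂ : ∫⁻ ξ, A₂ ξ ≤ ENNReal.ofReal K * P₂ ^ 2)
    (hA₃ : ∫⁻ ξ, A₃ ξ ≤ ENNReal.ofReal K * P₃ ^ 2) {κ g₁ g₂ g₃ : ℤ → ℝ≥0∞}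
    (hκ : ∀ j, κ j ≠ ⊤) (hg₁ : ∀ j, g₁ j ≠ ⊤) (hg₂ : ∀ j, g₂ j ≠ ⊤) (hg₃ : ∀ j, g₃ j ≠ ⊤)
    (hpt : ∀ j, ∀ ξ ∈ dyadicAnnulus d j, (κ j * H ξ) ^ 2 ≤
      ENNReal.ofReal K * (g₁ j ^ 2 * A₁ ξ + g₂ j ^ 2 * A₂ ξ + g₃ j ^ 2 * A₃ ξ)) :
    ∃ c : ℤ → ℝ, (∀ j, 0 ≤ c j) ∧ Summable (fun j => c j ^ 2) ∧ ∑' j, c j ^ 2 ≤ 1 ∧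
      ∀ j, κ j ^ 2 * ∫⁻ ξ in dyadicAnnulus d j, H ξ ^ 2 ≤
        (ENNReal.ofReal ((3 * K + 1) * c j) * (g₁ j * P₁ + g₂ j * P₂ + g₃ j * P₃)) ^ 2 := by
  have htop : ∀ {P : ℝ≥0∞}, P ≠ ⊤ → 2 * (ENNReal.ofReal K * P ^ 2) ≠ ⊤ := fun hP =>
    ENNReal.mul_ne_top ENNReal.ofNat_ne_top
      (ENNReal.mul_ne_top ENNReal.ofReal_ne_top (ENNReal.pow_ne_top hP))
  obtain ⟨e₁, n₁, s₁, t₁, b₁⟩ := exists_summable_le_mul (htop hP₁)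
    ((tsum_lintegral_dyadicAnnulus_le A₁).trans (mul_le_mul' le_rfl hA₁))
  obtain ⟨e₂, n₂, s₂, t₂, b₂⟩ := exists_summable_le_mul (htop hP₂)
    ((tsum_lintegral_dyadicAnnulus_le A₂).trans (mul_le_mul' le_rfl hA₂))
  obtain ⟨e₃, n₃, s₃, t₃, b₃⟩ := exists_summable_le_mul (htop hP₃)
    ((tsum_lintegral_dyadicAnnulus_le A₃).trans (mul_le_mul' le_rfl hA₃))
  set e : ℤ → ℝ := fun j => (e₁ j + e₂ j + e₃ j) / 3 with he
  have he0 : ∀ j, 0 ≤ e j := fun j => by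
    have := n₁ j
    have := n₂ j
    have := n₃ j
    simp only [he]
    positivity
  have hsq : ∀ j, √(e j) ^ 2 = e j := fun j => Real.sq_sqrt (he0 j)
  have hes : Summable e := ((s₁.add s₂).add s₃).div_const 3
  refine ⟨fun j => √(e j), fun j => Real.sqrt_nonneg _, ?_, ?_, fun j => ?_⟩
  · simpa only [hsq] using hes
  · simp only [hsq]
    have : ∑' j, e j = (∑' j, e₁ j + ∑' j, e₂ j + ∑' j, e₃ j) / 3 := by
      rw [← s₁.tsum_add s₂, ← (s₁.add s₂).tsum_add s₃, ← tsum_div_const]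
    linarith
  · have hi : ∀ {x : ℝ} {α P : ℝ≥0∞}, x ≤ 3 * e j →
        α ≤ ENNReal.ofReal x * (2 * (ENNReal.ofReal K * P ^ 2)) →
        α ≤ ENNReal.ofReal (6 * K * e j) * P ^ 2 := by
      intro x α P hx hα
      refine hα.trans ?_
      rw [← mul_assoc, ← mul_assoc, ← ENNReal.ofReal_ofNat, ← ENNReal.ofReal_mul' (by norm_num),
        ← ENNReal.ofReal_mul' hK]
      refine mul_le_mul' (ENNReal.ofReal_le_ofReal ?_) le_rfl
      calc x * 2 * K ≤ 3 * e j * 2 * K := by gcongr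
        _ = 6 * K * e j := by ring
    have hn₁ := n₁ j
    have hn₂ := n₂ j
    have hn₃ := n₃ j
    have c₁ := hi (by simp only [he]; linarith) (b₁ j)
    have c₂ := hi (by simp only [he]; linarith) (b₂ j)
    have c₃ := hi (by simp only [he]; linarith) (b₃ j)
    calc κ j ^ 2 * ∫⁻ ξ in dyadicAnnulus d j, H ξ ^ 2
        = ∫⁻ ξ in dyadicAnnulus d j, (κ j * H ξ) ^ 2 := by
          rw [← lintegral_const_mul' _ _ (ENNReal.pow_ne_top (hκ j))]
          simp_rw [mul_pow]
      _ ≤ ∫⁻ ξ in dyadicAnnulus d j, ENNReal.ofReal K *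
            (g₁ j ^ 2 * A₁ ξ + g₂ j ^ 2 * A₂ ξ + g₃ j ^ 2 * A₃ ξ) :=
          setLIntegral_mono' (measurableSet_dyadicAnnulus d j) (hpt j)
      _ = ENNReal.ofReal K * (g₁ j ^ 2 * (∫⁻ ξ in dyadicAnnulus d j, A₁ ξ) +
            g₂ j ^ 2 * (∫⁻ ξ in dyadicAnnulus d j, A₂ ξ) +
            g₃ j ^ 2 * ∫⁻ ξ in dyadicAnnulus d j, A₃ ξ) := by
          rw [lintegral_const_mul' _ _ ENNReal.ofReal_ne_top,
            lintegral_add_left (by fun_prop), lintegral_add_left (by fun_prop),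
            lintegral_const_mul' _ _ (ENNReal.pow_ne_top (hg₁ j)),
            lintegral_const_mul' _ _ (ENNReal.pow_ne_top (hg₂ j)),
            lintegral_const_mul' _ _ (ENNReal.pow_ne_top (hg₃ j))]
      _ ≤ ENNReal.ofReal K * (g₁ j ^ 2 * (ENNReal.ofReal (6 * K * e j) * P₁ ^ 2) +
            g₂ j ^ 2 * (ENNReal.ofReal (6 * K * e j) * P₂ ^ 2) +
            g₃ j ^ 2 * (ENNReal.ofReal (6 * K * e j) * P₃ ^ 2)) := by gcongr
      _ = ENNReal.ofReal (K * (6 * K * e j)) *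
            ((g₁ j * P₁) ^ 2 + (g₂ j * P₂) ^ 2 + (g₃ j * P₃) ^ 2) := by
          rw [ENNReal.ofReal_mul hK]
          ring
      _ ≤ ENNReal.ofReal (((3 * K + 1) * √(e j)) ^ 2) *
            (g₁ j * P₁ + g₂ j * P₂ + g₃ j * P₃) ^ 2 := by
          gcongr
          · rw [mul_pow, hsq]
            nlinarith [he0 j, mul_nonneg hK (he0 j), mul_nonneg (mul_nonneg hK hK) (he0 j)]
          · exact sum_three_sq_le _ _ _
      _ = _ := by
          rw [ENNReal.ofReal_pow (by positivity)]
          ring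

/-- The pointwise bound at `y = |ξ|`, integrated over all `ξ`. Where `Γ` vanishes the inverse is `0`
by convention, and the bound remains true. -/
theorem lintegral_weighted_conv_le {d : ℕ} (hd : 1 ≤ d) {H A₁ A₂ A₃ : E d → ℝ≥0∞}
    (m₁ : Measurable A₁) (m₂ : Measurable A₂) {P₁ P₂ P₃ : ℝ≥0∞} {K : ℝ}
    (hA₁ : ∫⁻ ξ, A₁ ξ ≤ ENNReal.ofReal K * P₁ ^ 2) (hA₂ : ∫⁻ ξ, A₂ ξ ≤ ENNReal.ofReal K * P₂ ^ 2)
    (hA₃ : ∫⁻ ξ, A₃ ξ ≤ ENNReal.ofReal K * P₃ ^ 2) {κ Γ₁ Γ₂ Γ₃ : ℝ → ℝ}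
    (hpt : ∀ ξ : E d, ξ ≠ 0 → (ENNReal.ofReal (κ ‖ξ‖) * H ξ) ^ 2 ≤
      ENNReal.ofReal K * (ENNReal.ofReal (Γ₁ ‖ξ‖) ^ 2 * A₁ ξ +
        ENNReal.ofReal (Γ₂ ‖ξ‖) ^ 2 * A₂ ξ + ENNReal.ofReal (Γ₃ ‖ξ‖) ^ 2 * A₃ ξ))
    {Γ : ℝ → ℝ} (hΓ : ∀ y, 0 ≤ y → 0 ≤ Γ y) (h₁ : ∀ y, Γ₁ y ≤ Γ y) (h₂ : ∀ y, Γ₂ y ≤ Γ y)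
    (h₃ : ∀ y, Γ₃ y ≤ Γ y) :
    ∫⁻ ξ, (ENNReal.ofReal (Γ ‖ξ‖)⁻¹ * (ENNReal.ofReal (κ ‖ξ‖) * H ξ)) ^ 2 ≤
      (ENNReal.ofReal K * (P₁ + P₂ + P₃)) ^ 2 := by
  have hle : ∀ (ξ : E d) (γ : ℝ), γ ≤ Γ ‖ξ‖ →
      ENNReal.ofReal (Γ ‖ξ‖)⁻¹ ^ 2 * ENNReal.ofReal γ ^ 2 ≤ 1 := by
    intro ξ γ hγ
    have h0 := hΓ _ (norm_nonneg ξ)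
    rw [← mul_pow, ← ENNReal.ofReal_mul (inv_nonneg.2 h0)]
    refine pow_le_one' (ENNReal.ofReal_le_one.2 ?_) 2
    exact (mul_le_mul_of_nonneg_left hγ (inv_nonneg.2 h0)).trans inv_mul_le_one
  calc ∫⁻ ξ, (ENNReal.ofReal (Γ ‖ξ‖)⁻¹ * (ENNReal.ofReal (κ ‖ξ‖) * H ξ)) ^ 2
      ≤ ∫⁻ ξ, ENNReal.ofReal K * (A₁ ξ + A₂ ξ + A₃ ξ) := by
        refine lintegral_mono_ae ?_
        filter_upwards [ae_ne_zero hd] with ξ hξ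
        rw [mul_pow]
        refine (mul_le_mul' le_rfl (hpt ξ hξ)).trans ?_
        calc _ = ENNReal.ofReal K *
              ((ENNReal.ofReal (Γ ‖ξ‖)⁻¹ ^ 2 * ENNReal.ofReal (Γ₁ ‖ξ‖) ^ 2) * A₁ ξ +
              (ENNReal.ofReal (Γ ‖ξ‖)⁻¹ ^ 2 * ENNReal.ofReal (Γ₂ ‖ξ‖) ^ 2) * A₂ ξ +
              (ENNReal.ofReal (Γ ‖ξ‖)⁻¹ ^ 2 * ENNReal.ofReal (Γ₃ ‖ξ‖) ^ 2) * A₃ ξ) := by ring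
          _ ≤ ENNReal.ofReal K * (1 * A₁ ξ + 1 * A₂ ξ + 1 * A₃ ξ) := by
              gcongr
              · exact hle ξ _ (h₁ _)
              · exact hle ξ _ (h₂ _)
              · exact hle ξ _ (h₃ _)
          _ = _ := by simp only [one_mul]
    _ = ENNReal.ofReal K * ((∫⁻ ξ, A₁ ξ) + (∫⁻ ξ, A₂ ξ) + ∫⁻ ξ, A₃ ξ) := by
        rw [lintegral_const_mul' _ _ ENNReal.ofReal_ne_top, lintegral_add_left (by fun_prop),
          lintegral_add_left (by fun_prop)]
    _ ≤ ENNReal.ofReal K * (ENNReal.ofReal K * P₁ ^ 2 + ENNReal.ofReal K * P₂ ^ 2 +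
          ENNReal.ofReal K * P₃ ^ 2) := by gcongr
    _ = ENNReal.ofReal K ^ 2 * (P₁ ^ 2 + P₂ ^ 2 + P₃ ^ 2) := by ring
    _ ≤ ENNReal.ofReal K ^ 2 * (P₁ + P₂ + P₃) ^ 2 := by
        gcongr
        exact sum_three_sq_le _ _ _
    _ = _ := (mul_pow _ _ _).symm

theorem enorm_conv_le {d : ℕ} (F G : E d → ℂ) (ξ : E d) :
    ‖conv F G ξ‖ₑ ≤ ∫⁻ ζ, ‖F ζ‖ₑ * ‖G (ξ - ζ)‖ₑ := by
  refine (enorm_integral_le_lintegral_enorm _).trans (le_of_eq ?_)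
  simp_rw [enorm_mul]

end WeightedProduct

end

open WeightedProduct in
theorem mainTheorem10 (d : ℕ) (hd : 2 ≤ d)
    (φ : 𝓢(WeightedProduct.E d, ℝ)) (hφ : WeightedProduct.IsDyadicGenerator φ)
    (s s' : ℝ) (hs : s ≤ (d : ℝ) / 2) (hs' : s' ≤ (d : ℝ) / 2) (hss' : 0 < s + s')
    (ω ω₁ ω₂ ω₃ ω₁' ω₂' ω₃' : ℝ → ℝ)
    (hω : WeightedProduct.IsWeight ω)
    (hω₁ : WeightedProduct.IsWeight ω₁) (hω₂ : WeightedProduct.IsWeight ω₂)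
    (hω₃ : WeightedProduct.IsWeight ω₃) (hω₁' : WeightedProduct.IsWeight ω₁')
    (hω₂' : WeightedProduct.IsWeight ω₂') (hω₃' : WeightedProduct.IsWeight ω₃')
    (Γ₁ Γ₂ Γ₃ : ℝ → ℝ)
    (hΓ₁ : ∀ y, 0 ≤ y → 0 ≤ Γ₁ y) (hΓ₂ : ∀ y, 0 ≤ y → 0 ≤ Γ₂ y) (hΓ₃ : ∀ y, 0 ≤ y → 0 ≤ Γ₃ y)
    (C₁ C₂ C₃ : ℝ) (hC₁ : 0 < C₁) (hC₂ : 0 < C₂) (hC₃ : 0 < C₃)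
    (hcond₁ : ∀ y, 0 ≤ y →
      ω y / ω₁' y * (WeightedProduct.lowIntegral d s ω₁ y) ^ ((1 : ℝ) / 2) ≤ C₁ * Γ₁ y)
    (hcond₂ : ∀ y, 0 ≤ y →
      ω y / ω₂' y * (WeightedProduct.lowIntegral d s' ω₂ y) ^ ((1 : ℝ) / 2) ≤ C₂ * Γ₂ y)
    (hcond₃ : ∀ y, 0 ≤ y → ω y / (ω₃ y * ω₃' y) ≤ C₃ * Γ₃ y) :
    ∃ C : ℝ, 0 < C ∧
      ∀ f g : 𝓢'(WeightedProduct.E d, ℂ),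
        WeightedProduct.lowNorm s ω₁ f < ⊤ → WeightedProduct.homNorm s' ω₁' g < ⊤ →
        WeightedProduct.lowNorm s' ω₂ g < ⊤ → WeightedProduct.homNorm s ω₂' f < ⊤ →
        WeightedProduct.homNorm s ω₃ f < ⊤ → WeightedProduct.homNorm s' ω₃' g < ⊤ →
        ∃ h : 𝓢'(WeightedProduct.E d, ℂ), WeightedProduct.IsProduct f g h ∧
          (∃ c : ℤ → ℝ, (∀ j, 0 ≤ c j) ∧ Summable (fun j => c j ^ 2) ∧ ∑' j, c j ^ 2 ≤ 1 ∧
            ∀ j : ℤ,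
              WeightedProduct.l2Norm (WeightedProduct.lpBlock φ j h) ≤
                ENNReal.ofReal (C * c j * (ω ((2 : ℝ) ^ j))⁻¹ *
                    (2 : ℝ) ^ (-(s + s' - (d : ℝ) / 2) * (j : ℝ))) *
                  (ENNReal.ofReal (Γ₁ ((2 : ℝ) ^ j)) * WeightedProduct.piNorm s s' ω₁ ω₁' f g +
                    ENNReal.ofReal (Γ₂ ((2 : ℝ) ^ j)) * WeightedProduct.piNorm s' s ω₂ ω₂' g f +
                    ENNReal.ofReal (Γ₃ ((2 : ℝ) ^ j)) *
                      WeightedProduct.rhoNorm s s' ω₃ ω₃' f g)) ∧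
          WeightedProduct.homNorm (s + s' - (d : ℝ) / 2)
              (fun r => ω r * (max (Γ₁ r) (max (Γ₂ r) (Γ₃ r)))⁻¹) h ≤
            ENNReal.ofReal C *
              (WeightedProduct.piNorm s s' ω₁ ω₁' f g + WeightedProduct.piNorm s' s ω₂ ω₂' g f +
                WeightedProduct.rhoNorm s s' ω₃ ω₃' f g) := by
  have hd1 : 1 ≤ d := by omega
  obtain ⟨K, hK, hmain⟩ := exists_convolution_bound hd1 hs hs' hss' hω hω₁ hω₂ hω₃ hω₁' hω₂' hω₃'
    hΓ₁ hΓ₂ hΓ₃ hcond₁ hcond₂ hcond₃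
  -- the constant produced by `exists_annulus_bound`; it also dominates the constant `K` of the norm
  -- estimate
  refine ⟨3 * K + 1, by positivity, fun f g hf₁ hg₁ hg₂ hf₂ hf₃ hg₃ => ?_⟩
  obtain ⟨F, hFm, hF⟩ := exists_measurable_density hf₃
  obtain ⟨G, hGm, hG⟩ := exists_measurable_density hg₃
  obtain ⟨N, hN⟩ := exists_integrable_decay_mul hd1 hss' hω₃ hω₃' hFm hGm hF.1 hG.1
    (by rw [← homNorm_sq hω₃ hF]; exact ENNReal.pow_lt_top hf₃)
    (by rw [← homNorm_sq hω₃' hG]; exact ENNReal.pow_lt_top hg₃)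
  obtain ⟨T, hT⟩ := exists_fourier_apply_eq_integral_conv hN
  have hloc := locallyIntegrable_conv hN
  have hTd : IsFourierDensity T (conv F G) := ⟨hloc, fun ψ _ => hT ψ⟩
  obtain ⟨A₁, A₂, A₃, m₁, m₂, -, hA₁, hA₂, hA₃, hpt⟩ :=
    hmain (fun ζ => ‖F ζ‖ₑ) (fun ζ => ‖G ζ‖ₑ) hFm.enorm hGm.enorm
  rw [← lowNorm_sq hω₁ hF, ← homNorm_sq hω₁' hG, ← mul_pow] at hA₁
  rw [← lowNorm_sq hω₂ hG, ← homNorm_sq hω₂' hF, ← mul_pow] at hA₂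
  rw [← homNorm_sq hω₃ hF, ← homNorm_sq hω₃' hG, ← mul_pow] at hA₃
  have hP₁ : piNorm s s' ω₁ ω₁' f g ≠ ⊤ := ENNReal.mul_ne_top hf₁.ne hg₁.ne
  have hP₂ : piNorm s' s ω₂ ω₂' g f ≠ ⊤ := ENNReal.mul_ne_top hg₂.ne hf₂.ne
  have hP₃ : rhoNorm s s' ω₃ ω₃' f g ≠ ⊤ := ENNReal.mul_ne_top hf₃.ne hg₃.ne
  refine ⟨T, isProduct_of_fourier_apply hF hG hFm hGm hN hT, ?_, ?_⟩
  · obtain ⟨c, hc0, hcs, hc1, hc⟩ := exists_annulus_bound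
      (H := fun ξ => ∫⁻ ζ, ‖F ζ‖ₑ * ‖G (ξ - ζ)‖ₑ) m₁ m₂ hP₁ hP₂ hP₃ hK hA₁ hA₂ hA₃
      (κ := fun j => ENNReal.ofReal
        (((2 : ℝ) ^ j) ^ (s + s' - (d : ℝ) / 2) * ω ((2 : ℝ) ^ j)))
      (g₁ := fun j => ENNReal.ofReal (Γ₁ ((2 : ℝ) ^ j)))
      (g₂ := fun j => ENNReal.ofReal (Γ₂ ((2 : ℝ) ^ j)))
      (g₃ := fun j => ENNReal.ofReal (Γ₃ ((2 : ℝ) ^ j)))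
      (fun _ => ENNReal.ofReal_ne_top) (fun _ => ENNReal.ofReal_ne_top)
      (fun _ => ENNReal.ofReal_ne_top) (fun _ => ENNReal.ofReal_ne_top)
      (fun j ξ hξ => by
        have h2 : (0 : ℝ) < 2 ^ j := by positivity
        obtain ⟨h3, h4⟩ := hξ
        rw [zpow_sub_one₀ two_ne_zero] at h3
        rw [zpow_add_one₀ two_ne_zero] at h4
        have hξ0 : ξ ≠ 0 := norm_pos_iff.1 (by linarith)
        exact hpt ξ hξ0 _ h2 (by linarith) (by linarith))
    refine ⟨c, hc0, hcs, hc1, fun j => ?_⟩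
    have h2 : (0 : ℝ) < 2 ^ j := by positivity
    have hω2 := hω.pos h2.le
    set κ : ℝ := ((2 : ℝ) ^ j) ^ (s + s' - (d : ℝ) / 2) * ω ((2 : ℝ) ^ j) with hκ
    have hκ0 : 0 < κ := by positivity
    have hl2 : l2Norm (lpBlock φ j T) ^ 2 ≤
        ∫⁻ ξ in dyadicAnnulus d j, (∫⁻ ζ, ‖F ζ‖ₑ * ‖G (ξ - ζ)‖ₑ) ^ 2 := by
      refine (pow_le_pow_left' (l2Norm_lpBlock_le hloc.aestronglyMeasurable hT φ j) 2).trans ?_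
      rw [eLpNorm_two_sq, ← lintegral_indicator (measurableSet_dyadicAnnulus d j)]
      refine lintegral_mono fun ξ => ?_
      rw [enorm_mul, mul_pow]
      have hφξ := enorm_dyadicSymbol_le hφ j ξ
      by_cases hξ : ξ ∈ dyadicAnnulus d j
      · rw [indicator_of_mem hξ] at hφξ ⊢
        refine (mul_le_of_le_one_left zero_le (pow_le_one' hφξ 2)).trans ?_
        exact pow_le_pow_left' (enorm_conv_le F G ξ) 2
      · rw [indicator_of_notMem hξ] at hφξ ⊢
        rw [nonpos_iff_eq_zero.1 hφξ, zero_pow two_ne_zero, zero_mul]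
    have hfin := (mul_le_mul' (le_refl (ENNReal.ofReal κ ^ 2)) hl2).trans (hc j)
    rw [← mul_pow, ENNReal.pow_le_pow_left_iff two_ne_zero] at hfin
    have hone : ENNReal.ofReal κ⁻¹ * ENNReal.ofReal κ = 1 := by
      rw [← ENNReal.ofReal_mul (by positivity), inv_mul_cancel₀ hκ0.ne', ENNReal.ofReal_one]
    have hκi : κ⁻¹ = (ω ((2 : ℝ) ^ j))⁻¹ * (2 : ℝ) ^ (-(s + s' - (d : ℝ) / 2) * (j : ℝ)) := by
      rw [hκ, mul_inv, mul_comm, ← Real.rpow_neg h2.le, ← Real.rpow_intCast,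
        ← Real.rpow_mul (by norm_num)]
      congr 2
      ring
    calc l2Norm (lpBlock φ j T)
        = ENNReal.ofReal κ⁻¹ * (ENNReal.ofReal κ * l2Norm (lpBlock φ j T)) := by
          rw [← mul_assoc, hone, one_mul]
      _ ≤ ENNReal.ofReal κ⁻¹ * (ENNReal.ofReal ((3 * K + 1) * c j) * _) := by gcongr
      _ = _ := by
          rw [← mul_assoc, ← ENNReal.ofReal_mul (by positivity), hκi]
          congr 2
          ring
  · have hbd := lintegral_weighted_conv_le hd1
      (H := fun ξ => ∫⁻ ζ, ‖F ζ‖ₑ * ‖G (ξ - ζ)‖ₑ) m₁ m₂ hA₁ hA₂ hA₃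
      (κ := fun r => r ^ (s + s' - (d : ℝ) / 2) * ω r) (Γ₁ := Γ₁) (Γ₂ := Γ₂) (Γ₃ := Γ₃)
      (fun ξ hξ => by
        have hξ' := norm_pos_iff.2 hξ
        exact hpt ξ hξ _ hξ' (by linarith) (by linarith))
      (Γ := fun r => max (Γ₁ r) (max (Γ₂ r) (Γ₃ r)))
      (fun y hy => (hΓ₁ y hy).trans (le_max_left _ _)) (fun y => le_max_left _ _)
      (fun y => (le_max_left _ _).trans (le_max_right _ _))
      (fun y => (le_max_right _ _).trans (le_max_right _ _))
    have hsq : homNorm (s + s' - (d : ℝ) / 2)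
        (fun r => ω r * (max (Γ₁ r) (max (Γ₂ r) (Γ₃ r)))⁻¹) T ^ 2 ≤
        (ENNReal.ofReal K * (piNorm s s' ω₁ ω₁' f g + piNorm s' s ω₂ ω₂' g f +
          rhoNorm s s' ω₃ ω₃' f g)) ^ 2 := by
      refine le_trans ?_ hbd
      rw [homNorm_eq _ _ hTd, eLpNorm_two_sq]
      refine lintegral_mono fun ξ => ?_
      have hωξ := hω.pos (norm_nonneg ξ)
      have hΓξ : 0 ≤ max (Γ₁ ‖ξ‖) (max (Γ₂ ‖ξ‖) (Γ₃ ‖ξ‖)) :=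
        (hΓ₁ _ (norm_nonneg ξ)).trans (le_max_left _ _)
      gcongr
      rw [enorm_mul, ← ofReal_norm, Complex.norm_real, Real.norm_of_nonneg (by positivity),
        ← mul_assoc, ← mul_assoc, ← ENNReal.ofReal_mul (inv_nonneg.2 hΓξ), mul_comm (max _ _)⁻¹]
      gcongr
      exact enorm_conv_le F G ξ
    rw [ENNReal.pow_le_pow_left_iff two_ne_zero] at hsq
    refine hsq.trans ?_
    gcongr
    linarith
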